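/- Let $\mathcal H$ be an infinite-dimensional separable complex Hilbert space, let $B(\mathcal H)^+$ be the set of positive bounded operators on $\mathcal H$ (with the Loewner order) and $B(\mathcal H)^{++}$ the set of invertible ones. A (Kubo–Ando) operator mean is a map $\sigma:B(\mathcal H)^+\times B(\mathcal H)^+\to B(\mathcal H)^+$ such that for $A,A',B,B',C\in B(\mathcal H)^+$: (I) $A\le A'$ and $B\le B'$ imply $A\sigma B\le A'\sigma B'$; (II) $C(A\sigma B)C\le(CAC)\sigma(CBC)$; (III) if $A_k\searrow A$ and $B_k\searrow B$ (decreasing sequences converging in the strong operator topology), then $A_k\sigma B_k\searrow A\sigma B$; (IV) $I\sigma I=I$. Its representing function is the continuous, non-negative operator monotone function $f_\sigma$ on $[0,\infty)$ with $f_\sigma(1)=1$ and $A\sigma B=A^{1/2}f_\sigma(A^{-1/2}BA^{-1/2})A^{1/2}$ for all $A,B\in B(\mathcal H)^{++}$. Let $\mathfrak l$ be the operator mean $A\,\mathfrak l\,B=A$. **Theorem.** Let $\tau,\sigma$ be operator means with $\sigma\ne\mathfrak l$. For all $A,B\in B(\mathcal H)^{++}$ the equation $$X=(X\sigma A)\tau(X\sigma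 B)$$ has a unique solution $X\in B(\mathcal H)^{++}$, denoted $A\tau_\sigma B$. For all $A,B\in B(\mathcal H)^+$ the limit $$A\tau_\sigma B:=\lim_{\varepsilon\searrow0}(A+\varepsilon I)\tau_\sigma(B+\varepsilon I)$$ exists in the strong operator topology and agrees with the previous definition when $A,B\in B(\mathcal H)^{++}$, and the binary operation $\tau_\sigma$ so defined on $B(\mathcal H)^+$ is an operator mean. Moreover, $\tau$, $\sigma$ and $\tau_\sigma$ have representing functions $f_\tau,f_\sigma,f_{\tau_\sigma}$, and for every $t>0$ the number $x=f_{\tau_\sigma}(t)$ is the unique $x>0$ satisfying $$\bigl((xI)\sigma I\bigr)\tau\bigl((xI)\sigma(tI)\bigr)=xI,$$ and equally the unique $x>0$ satisfying $$f_\sigma(1/x)\,f_\tau\!\left(\frac{f_\sigma(t/x)}{f_\sigma(1/x)}\right)=1 .$$ -/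

import Mathlib

open Filter Topology
open scoped NNReal

/-- The cone of positive bounded operators on a complex Hilbert space, with the Loewner order. -/
abbrev PosOp (H : Type*) [NormedAddCommGroup H] [InnerProductSpace ℂ H] [CompleteSpace H] :=
  {A : H →L[ℂ] H // 0 ≤ A}

section OperatorMeans

variable {H : Type*} [NormedAddCommGroup H] [InnerProductSpace ℂ H] [CompleteSpace H]

namespace PosOp

/-- `A` is a positive operator which is invertible. -/
def Inv (A : PosOp H) : Prop := IsUnit (A : H →L[ℂ] H)

/-- The positive operator `C A C`. -/
def conj (C A : PosOp H) : PosOp H :=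
  ⟨C.1 * A.1 * C.1, (IsSelfAdjoint.of_nonneg C.2).conjugate_nonneg A.2⟩

/-- The scalar operator `t I` for a real number `t ≥ 0`. -/
noncomputable def scalar (H : Type*) [NormedAddCommGroup H] [InnerProductSpace ℂ H]
    [CompleteSpace H] (t : ℝ≥0) : PosOp H :=
  ⟨algebraMap ℝ≥0 (H →L[ℂ] H) t, algebraMap_nonneg _ t.2⟩

/-- Convergence in the strong operator topology along a filter. -/
def TendstoSOT {ι : Type*} (A : ι → PosOp H) (l : Filter ι) (L : PosOp H) : Prop :=
  ∀ ξ : H, Tendsto (fun i => (A i : H →L[ℂ] H) ξ) l (𝓝 ((L : H →L[ℂ] H) ξ))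

/-- `A k ↘ L`: the sequence is decreasing and converges to `L` strongly. -/
def Decreases (A : ℕ → PosOp H) (L : PosOp H) : Prop :=
  Antitone A ∧ TendstoSOT A atTop L

end PosOp

/-- Operator means in the sense of Kubo and Ando: binary operations on the positive operators
that are jointly monotone, satisfy the transformer inequality, are downward continuous and
normalized. -/
structure IsOperatorMean (m : PosOp H → PosOp H → PosOp H) : Prop where
  mono : ∀ A A' B B' : PosOp H, A ≤ A' → B ≤ B' → m A B ≤ m A' B'
  transformer : ∀ A B C : PosOp H, C.conj (m A B) ≤ m (C.conj A) (C.conj B)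
  downward : ∀ (A B : ℕ → PosOp H) (A₀ B₀ : PosOp H), PosOp.Decreases A A₀ →
    PosOp.Decreases B B₀ → PosOp.Decreases (fun k => m (A k) (B k)) (m A₀ B₀)
  normalized : m (PosOp.scalar H 1) (PosOp.scalar H 1) = PosOp.scalar H 1

/-- The left trivial mean `(A, B) ↦ A`. -/
def leftMean (H : Type*) [NormedAddCommGroup H] [InnerProductSpace ℂ H] [CompleteSpace H] :
    PosOp H → PosOp H → PosOp H :=
  fun A _ => A

/-- `f` is the representing function of the operation `m`: a non-negative (continuous) operator
monotone function on `[0, ∞)` with `f 1 = 1` and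
`m A B = A^{1/2} f(A^{-1/2} B A^{-1/2}) A^{1/2}` for positive invertible `A`, `B`. -/
structure IsRepresentingFunction (m : PosOp H → PosOp H → PosOp H) (f : ℝ≥0 → ℝ≥0) : Prop where
  continuous : Continuous f
  operatorMonotone : ∀ A B : PosOp H, A ≤ B → cfc f (A : H →L[ℂ] H) ≤ cfc f (B : H →L[ℂ] H)
  map_one : f 1 = 1
  formula : ∀ A B : PosOp H, A.Inv → B.Inv →
    (m A B : H →L[ℂ] H) =
      A.1 ^ (1 / 2 : ℝ) *
        cfc f (A.1 ^ (-(1 / 2) : ℝ) * B.1 * A.1 ^ (-(1 / 2) : ℝ)) * A.1 ^ (1 / 2 : ℝ)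

/-- A representing function is unique. -/
theorem IsRepresentingFunction.unique [Nontrivial H] {m : PosOp H → PosOp H → PosOp H}
    {f g : ℝ≥0 → ℝ≥0} (hf : IsRepresentingFunction m f) (hg : IsRepresentingFunction m g) :
    f = g := by
  have key : ∀ t : ℝ≥0, t ≠ 0 → f t = g t := by
    intro t ht
    have h1 : (PosOp.scalar H 1).Inv := by simp [PosOp.Inv, PosOp.scalar]
    have h2 : (PosOp.scalar H t).Inv := (IsUnit.mk0 t ht).map (algebraMap ℝ≥0 (H →L[ℂ] H))
    have h := (hf.formula _ _ h1 h2).symm.trans (hg.formula _ _ h1 h2)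
    simp only [PosOp.scalar, _root_.map_one, CFC.one_rpow, one_mul, mul_one] at h
    rw [cfc_algebraMap, cfc_algebraMap] at h
    rw [IsScalarTower.algebraMap_apply ℝ≥0 ℝ (H →L[ℂ] H),
      IsScalarTower.algebraMap_apply ℝ≥0 ℝ (H →L[ℂ] H)] at h
    exact NNReal.coe_injective ((algebraMap ℝ (H →L[ℂ] H)).injective h)
  have hd : Dense {t : ℝ≥0 | t ≠ 0} := dense_compl_singleton 0
  exact Continuous.ext_on hd hf.continuous hg.continuous (fun t ht => key t ht)

/-- `X` is a positive invertible solution of `X = (X σ A) τ (X σ B)`. -/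
def IsFixedSolution (τ σ : PosOp H → PosOp H → PosOp H) (A B X : PosOp H) : Prop :=
  X.Inv ∧ X = τ (σ X A) (σ X B)

/-- `ρ` is the deformation of `τ` by `σ`: for positive invertible `A`, `B`, the operator `ρ A B`
is the unique positive invertible solution of `X = (X σ A) τ (X σ B)`, and for all positive
`A`, `B` it is the strong limit of `ρ (A + ε I) (B + ε I)` as `ε ↘ 0`. -/
structure IsDeformation (τ σ ρ : PosOp H → PosOp H → PosOp H) : Prop where
  solution : ∀ A B : PosOp H, A.Inv → B.Inv →
    IsFixedSolution τ σ A B (ρ A B) ∧ ∀ X : PosOp H, IsFixedSolution τ σ A B X → X = ρ A B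
  regularization : ∀ A B : PosOp H,
    PosOp.TendstoSOT (fun ε : ℝ≥0 => ρ (A + PosOp.scalar H ε) (B + PosOp.scalar H ε))
      (𝓝[>] 0) (ρ A B)

end OperatorMeans

/-! ### Congruence, localisation, and the scalar function of a mean. -/

section MeanBasics

variable {H : Type*} [NormedAddCommGroup H] [InnerProductSpace ℂ H] [CompleteSpace H]

namespace PosOp

/-! Existence is a monotone iteration. The map `X ↦ (X σ A) τ (X σ B)` is monotone, fixes `t I` when
`A = B = t I`, and respects decreasing strong limits. Iterating it downwards from a large scalar
therefore converges to a fixed point, invertible because small scalars are subsolutions and lying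
above any subsolution covered by the starting scalar (`exists_isFixedSolution`).

Uniqueness is a scaling argument (`IsFixedSolution.le`). Take the least `α` with `X ≤ α Y`. If `α >
1`, homogeneity and strict monotonicity of `f_σ` improve this to `X ≤ α β Y` with `β < 1`, a
contradiction. Strictness comes from a rigidity fact (`eq_of_repFun_eq`): both `f` and `x ↦ 1 / f (1
/ x)` are concave, so an `f` taking the same value at two positive points is constant on `(0, ∞)`,
and then the mean is `leftMean`.

The representing function is built from the axioms. Projections commuting with both arguments
commute with the mean, so `I m (t I)` is a scalar `f(t) I`; cutting the spectrum of `A` into short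
bands then gives `I m A = f(A)` (`one_left`), and congruence by `A^{1/2}` gives the general formula.

The mean axioms for the deformation follow from comparison, uniqueness and monotone limits. The
scalar equations are the fixed point equation for `A = I`, `B = t I`. -/

theorem isSelfAdjoint (A : PosOp H) : IsSelfAdjoint A.1 := IsSelfAdjoint.of_nonneg A.2

theorem conj_mono (C : PosOp H) {A B : PosOp H} (h : A ≤ B) : C.conj A ≤ C.conj B :=
  IsSelfAdjoint.conjugate_le_conjugate (show A.1 ≤ B.1 from h) C.isSelfAdjoint

theorem coe_conj (C A : PosOp H) : (C.conj A).1 = C.1 * A.1 * C.1 := rfl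

theorem coe_scalar (t : ℝ≥0) : (scalar H t).1 = (t : ℝ) • (1 : H →L[ℂ] H) := by
  rw [← Algebra.algebraMap_eq_smul_one]; rfl

theorem coe_add (A B : PosOp H) : (A + B).1 = A.1 + B.1 := rfl

theorem scalar_one : (scalar H 1).1 = 1 := by simp [coe_scalar]

theorem scalar_mono {s t : ℝ≥0} (h : s ≤ t) : scalar H s ≤ scalar H t := by
  change (scalar H s).1 ≤ (scalar H t).1
  rw [coe_scalar, coe_scalar]
  exact smul_le_smul_of_nonneg_right (by exact_mod_cast h) zero_le_one

theorem scalar_inv {t : ℝ≥0} (ht : t ≠ 0) : (scalar H t).Inv :=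
  (IsUnit.mk0 t ht).map (algebraMap ℝ≥0 (H →L[ℂ] H))

theorem scalar_injective [Nontrivial H] {s t : ℝ≥0} (h : scalar H s = scalar H t) : s = t := by
  have h1 : (scalar H s).1 = (scalar H t).1 := by rw [h]
  rw [coe_scalar, coe_scalar] at h1
  exact_mod_cast smul_left_injective ℝ (one_ne_zero (α := H →L[ℂ] H)) h1

theorem scalar_le_iff [Nontrivial H] {s t : ℝ≥0} : scalar H s ≤ scalar H t ↔ s ≤ t := by
  refine ⟨fun h => ?_, scalar_mono⟩
  rcases le_total s t with h1 | h1
  · exact h1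
  · exact (scalar_injective (le_antisymm h (scalar_mono h1))).le

theorem conj_scalar_scalar (s t : ℝ≥0) : (scalar H s).conj (scalar H t) = scalar H (s * s * t) := by
  apply Subtype.ext
  simp only [coe_conj, coe_scalar, mul_smul_comm, smul_smul, mul_one]
  congr 1
  push_cast; ring

theorem conj_conj_cancel {C D : PosOp H} (h1 : C.1 * D.1 = 1) (h2 : D.1 * C.1 = 1) (A : PosOp H) :
    C.conj (D.conj A) = A := by
  apply Subtype.ext
  change C.1 * (D.1 * A.1 * D.1) * C.1 = A.1
  calc C.1 * (D.1 * A.1 * D.1) * C.1 = (C.1 * D.1) * A.1 * (D.1 * C.1) := by noncomm_ring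
    _ = A.1 := by rw [h1, h2]; simp

end PosOp

/-- `P Q P` is `(√Q P)* (√Q P)`, so the C*-identity gives `√Q P = 0`. -/
theorem mul_eq_zero_of_conj_eq_zero {Q P : H →L[ℂ] H} (hQ : 0 ≤ Q) (hP : IsSelfAdjoint P)
    (h : P * Q * P = 0) : Q * P = 0 := by
  have h1 := CFC.sqrt_mul_sqrt_self Q hQ
  have h2 : CFC.sqrt Q * P = 0 := by
    rw [← CStarRing.star_mul_self_eq_zero_iff, star_mul, hP.star_eq,
      (IsSelfAdjoint.of_nonneg (CFC.sqrt_nonneg Q)).star_eq, ← h]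
    nth_rewrite 3 [← h1]
    simp only [mul_assoc]
  rw [← h1, mul_assoc, h2, mul_zero]

/-- The difference `A - P A P` equals `(1 - P) A (1 - P)`. -/
theorem conj_le_self_of_commute {P A : H →L[ℂ] H} (hP : IsStarProjection P) (hA : 0 ≤ A)
    (h : Commute P A) : P * A * P ≤ A := by
  have h1 := hP.one_sub.isSelfAdjoint.conjugate_nonneg hA
  have h2 : (1 - P) * A * (1 - P) = A - P * A * P := by
    have h3 : P * A = A * P := h
    have h4 : P * P = P := hP.isIdempotentElem
    have : (1 - P) * A * (1 - P) = A - P * A - A * P + P * A * P := by noncomm_ring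
    rw [this, ← h3, mul_assoc P A P, ← h3, ← mul_assoc, h4]
    abel
  rw [h2] at h1
  exact sub_nonneg.mp h1

namespace IsOperatorMean

variable {m : PosOp H → PosOp H → PosOp H}

/-- The reverse inequality is the transformer inequality for the inverse `D`, conjugated back by
`C`. -/
theorem conj_eq (hm : IsOperatorMean m) {C D : PosOp H} (h1 : C.1 * D.1 = 1) (h2 : D.1 * C.1 = 1)
    (A B : PosOp H) : C.conj (m A B) = m (C.conj A) (C.conj B) := by
  refine le_antisymm (hm.transformer A B C) ?_
  have h := C.conj_mono (hm.transformer (C.conj A) (C.conj B) D)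
  rwa [PosOp.conj_conj_cancel h1 h2, PosOp.conj_conj_cancel h2 h1,
    PosOp.conj_conj_cancel h2 h1] at h

/-- Monotonicity and the transformer inequality give `P Y P ≤ Y` for `Y = m A B`. The positive
operator `Y - P Y P` has zero `P`-corner, so it annihilates `P`; adjoints then give commutation. -/
theorem commute_of_commute (hm : IsOperatorMean m) {P A B : PosOp H} (hP : IsStarProjection P.1)
    (hA : Commute P.1 A.1) (hB : Commute P.1 B.1) : Commute P.1 (m A B).1 := by
  have hc : P.conj (m A B) ≤ m A B := (hm.transformer A B P).trans
    (hm.mono _ _ _ _ (conj_le_self_of_commute hP A.2 hA) (conj_le_self_of_commute hP B.2 hB))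
  set Y := (m A B).1 with hY
  have hc' : 0 ≤ Y - P.1 * Y * P.1 := sub_nonneg.mpr hc
  have hPP : P.1 * P.1 = P.1 := hP.isIdempotentElem
  have h1 : (Y - P.1 * Y * P.1) * P.1 = 0 := by
    apply mul_eq_zero_of_conj_eq_zero hc' P.isSelfAdjoint
    have : P.1 * (Y - P.1 * Y * P.1) * P.1 = P.1 * Y * P.1 - (P.1 * P.1) * Y * (P.1 * P.1) := by
      noncomm_ring
    rw [this, hPP, sub_self]
  have h2 : Y * P.1 = P.1 * Y * P.1 := by
    rw [sub_mul, mul_assoc _ P.1 P.1, hPP, sub_eq_zero] at h1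
    exact h1
  have h3 := congrArg star h2
  have hYs : star Y = Y := (m A B).isSelfAdjoint.star_eq
  simp only [star_mul, P.isSelfAdjoint.star_eq, hYs] at h3
  rw [Commute, SemiconjBy, h3, ← mul_assoc, ← h2]

/-- Localisation: the `P`-block of a mean depends only on the `P`-blocks of its arguments. -/
theorem conj_conj_eq (hm : IsOperatorMean m) {P A B : PosOp H} (hP : IsStarProjection P.1)
    (hA : Commute P.1 A.1) (hB : Commute P.1 B.1) :
    P.conj (m (P.conj A) (P.conj B)) = P.conj (m A B) := by
  refine le_antisymm (P.conj_mono (hm.mono _ _ _ _ (conj_le_self_of_commute hP A.2 hA)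
    (conj_le_self_of_commute hP B.2 hB))) ?_
  have h := P.conj_mono (hm.transformer A B P)
  have hPP : P.1 * P.1 = P.1 := hP.isIdempotentElem
  have h2 : P.conj (P.conj (m A B)) = P.conj (m A B) := by
    apply Subtype.ext
    simp only [PosOp.coe_conj]
    calc P.1 * (P.1 * (m A B).1 * P.1) * P.1 = (P.1 * P.1) * (m A B).1 * (P.1 * P.1) := by
          noncomm_ring
      _ = _ := by rw [hPP]
  rwa [h2] at h

end IsOperatorMean

/-- The orthogonal projection onto a closed subspace, as a positive operator. -/
noncomputable def PosOp.proj (U : Submodule ℂ H) [U.HasOrthogonalProjection] : PosOp H :=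
  ⟨U.starProjection, (isStarProjection_starProjection (U := U)).nonneg⟩

theorem PosOp.isStarProjection_proj (U : Submodule ℂ H) [U.HasOrthogonalProjection] :
    IsStarProjection (PosOp.proj U).1 := isStarProjection_starProjection (U := U)

theorem PosOp.commute_scalar (P : H →L[ℂ] H) (t : ℝ≥0) : Commute P (PosOp.scalar H t).1 := by
  rw [PosOp.coe_scalar]
  exact (Commute.one_right P).smul_right _

open scoped ComplexOrder in
-- Commuting with the projection onto each line makes every vector an eigenvector.
theorem exists_eq_scalar_of_commute {Y : PosOp H}
    (hY : ∀ P : PosOp H, IsStarProjection P.1 → Commute P.1 Y.1) :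
    ∃ t : ℝ≥0, Y = PosOp.scalar H t := by
  by_cases hn : Nontrivial H
  swap
  · refine ⟨0, Subtype.ext (ContinuousLinearMap.ext fun x => ?_)⟩
    rw [not_nontrivial_iff_subsingleton] at hn
    exact Subsingleton.elim _ _
  obtain ⟨c, hc⟩ : ∃ c : ℂ, (Y.1 : H →ₗ[ℂ] H) = c • LinearMap.id := by
    obtain ⟨c, hc⟩ := LinearMap.exists_eq_smul_id_of_forall_notLinearIndependent
      (f := (Y.1 : H →ₗ[ℂ] H)) (fun v => by
        have h1 := hY (PosOp.proj (ℂ ∙ v)) (PosOp.isStarProjection_proj _)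
        have h2 := congrArg (fun T : H →L[ℂ] H => T v) h1.eq
        change (ℂ ∙ v).starProjection (Y.1 v) = Y.1 ((ℂ ∙ v).starProjection v) at h2
        rw [Submodule.starProjection_eq_self_iff.mpr (Submodule.mem_span_singleton_self v)] at h2
        have h3 : Y.1 v ∈ ℂ ∙ v := by
          rw [← h2]; exact Submodule.starProjection_apply_mem _ _
        obtain ⟨a, ha⟩ := Submodule.mem_span_singleton.mp h3
        rw [LinearIndependent.pair_iff]
        intro h
        have := h a (-1) (by simp [ha])
        simp at this)
    exact ⟨c, hc⟩
  have hc' : Y.1 = c • (1 : H →L[ℂ] H) := by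
    ext x
    have := congrArg (fun T : H →ₗ[ℂ] H => T x) hc
    simpa using this
  obtain ⟨v, hv⟩ := exists_ne (0 : H)
  have hpos := ((ContinuousLinearMap.nonneg_iff_isPositive _).mp Y.2).inner_nonneg_right v
  rw [hc'] at hpos
  simp only [smul_apply, one_apply_eq_self, inner_smul_right] at hpos
  rw [inner_self_eq_norm_sq_to_K, ← RCLike.ofReal_pow, mul_comm] at hpos
  have hv2 : 0 < ‖v‖ ^ 2 := by positivity
  have hc0 : 0 ≤ c := by
    rw [Complex.nonneg_iff] at hpos ⊢
    have h1 := hpos.1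
    have h2 := hpos.2
    erw [Complex.re_ofReal_mul] at h1
    erw [Complex.im_ofReal_mul] at h2
    exact ⟨nonneg_of_mul_nonneg_right h1 hv2,
      ((mul_eq_zero.mp h2.symm).resolve_left hv2.ne').symm⟩
  refine ⟨c.re.toNNReal, Subtype.ext ?_⟩
  rw [PosOp.coe_scalar, hc']
  ext x
  have : c = (c.re : ℂ) := Complex.ext rfl (by simpa using (Complex.nonneg_iff.mp hc0).2.symm)
  simp only [smul_apply, one_apply_eq_self,
    Real.coe_toNNReal _ (Complex.nonneg_iff.mp hc0).1]
  rw [this]; simp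

/-- The scalar function attached to a binary operation `m` by `I m (t I) = f(t) I`. -/
noncomputable def repFun (m : PosOp H → PosOp H → PosOp H) (t : ℝ≥0) : ℝ≥0 :=
  ‖(m (PosOp.scalar H 1) (PosOp.scalar H t)).1‖₊

namespace IsOperatorMean

variable {m : PosOp H → PosOp H → PosOp H} [Nontrivial H]

theorem one_scalar (hm : IsOperatorMean m) (t : ℝ≥0) :
    m (PosOp.scalar H 1) (PosOp.scalar H t) = PosOp.scalar H (repFun m t) := by
  obtain ⟨s, hs⟩ := exists_eq_scalar_of_commute
    (Y := m (PosOp.scalar H 1) (PosOp.scalar H t)) fun P hP =>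
      hm.commute_of_commute hP (PosOp.commute_scalar _ _) (PosOp.commute_scalar _ _)
  have : repFun m t = s := by
    rw [repFun, hs, PosOp.coe_scalar, nnnorm_smul]
    simp
  rw [hs, this]

omit [Nontrivial H] in
theorem conj_scalar (hm : IsOperatorMean m) {t : ℝ≥0} (ht : t ≠ 0) (A B : PosOp H) :
    (PosOp.scalar H t).conj (m A B) = m ((PosOp.scalar H t).conj A) ((PosOp.scalar H t).conj B) := by
  have h : (t : ℝ) ≠ 0 := by exact_mod_cast ht
  apply hm.conj_eq (D := PosOp.scalar H t⁻¹) <;>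
    simp [PosOp.coe_scalar, smul_smul, h]

theorem scalar_scalar (hm : IsOperatorMean m) {s : ℝ≥0} (hs : s ≠ 0) (t : ℝ≥0) :
    m (PosOp.scalar H s) (PosOp.scalar H t) = PosOp.scalar H (s * repFun m (t / s)) := by
  have hs' : NNReal.sqrt s ≠ 0 := by simpa using hs
  have h := hm.conj_scalar hs' (PosOp.scalar H 1) (PosOp.scalar H (t / s))
  rw [hm.one_scalar, PosOp.conj_scalar_scalar, PosOp.conj_scalar_scalar,
    PosOp.conj_scalar_scalar, NNReal.mul_self_sqrt, mul_one, mul_div_cancel₀ _ hs] at h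
  exact h.symm

theorem repFun_one (hm : IsOperatorMean m) : repFun m 1 = 1 :=
  PosOp.scalar_injective ((hm.one_scalar 1).symm.trans hm.normalized)

theorem repFun_mono (hm : IsOperatorMean m) : Monotone (repFun m) := fun s t h => by
  rw [← PosOp.scalar_le_iff (H := H), ← hm.one_scalar, ← hm.one_scalar]
  exact hm.mono _ _ _ _ le_rfl (PosOp.scalar_mono h)

/-- By homogeneity `f(t)/t` is the scalar of `(t⁻¹ I) m I`, which decreases in `t` by monotonicity
in the first argument. -/
theorem repFun_mul_le (hm : IsOperatorMean m) {t u : ℝ≥0} (h : t ≤ u) :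
    repFun m u * t ≤ repFun m t * u := by
  rcases eq_or_ne t 0 with rfl | ht
  · simp
  have hu : u ≠ 0 := (lt_of_lt_of_le (pos_iff_ne_zero.mpr ht) h).ne'
  have h1 := hm.mono (PosOp.scalar H u⁻¹) (PosOp.scalar H t⁻¹) (PosOp.scalar H 1)
    (PosOp.scalar H 1) (PosOp.scalar_mono (inv_anti₀ (pos_iff_ne_zero.mpr ht) h)) le_rfl
  rw [hm.scalar_scalar (inv_ne_zero hu), hm.scalar_scalar (inv_ne_zero ht),
    PosOp.scalar_le_iff] at h1
  simp only [one_div, inv_inv] at h1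
  have h2 := mul_le_mul_right h1 (u * t)
  calc repFun m u * t = u * t * (u⁻¹ * repFun m u) := by field_simp
    _ ≤ u * t * (t⁻¹ * repFun m t) := h2
    _ = _ := by field_simp

theorem repFun_pos (hm : IsOperatorMean m) {t : ℝ≥0} (ht : 0 < t) : 0 < repFun m t := by
  rcases le_total t 1 with h | h
  · have := hm.repFun_mul_le h
    rw [hm.repFun_one, one_mul, mul_one] at this
    exact ht.trans_le this
  · exact zero_lt_one.trans_le (hm.repFun_one ▸ hm.repFun_mono h)

omit [Nontrivial H] in
theorem _root_.PosOp.tendstoSOT_scalar {ι : Type*} {l : Filter ι} {u : ι → ℝ≥0} {t : ℝ≥0}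
    (h : Tendsto u l (𝓝 t)) :
    PosOp.TendstoSOT (fun i => PosOp.scalar H (u i)) l (PosOp.scalar H t) := fun ξ => by
  simp only [PosOp.coe_scalar]
  exact (((NNReal.continuous_coe.tendsto t).comp h).smul_const ((1 : H →L[ℂ] H) ξ))

theorem _root_.PosOp.tendsto_of_tendstoSOT_scalar {ι : Type*} {l : Filter ι} {u : ι → ℝ≥0} {t : ℝ≥0}
    (h : PosOp.TendstoSOT (fun i => PosOp.scalar H (u i)) l (PosOp.scalar H t)) :
    Tendsto u l (𝓝 t) := by
  obtain ⟨v, hv⟩ := exists_ne (0 : H)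
  have h1 := (h v).nnnorm
  simp only [PosOp.coe_scalar, smul_apply, one_apply_eq_self,
    nnnorm_smul, Real.nnnorm_of_nonneg (NNReal.coe_nonneg _)] at h1
  have h2 := h1.mul_const ‖v‖₊⁻¹
  have hv' : ‖v‖₊ ≠ 0 := by simpa using hv
  simpa [mul_assoc, hv'] using h2

/-- At `0` this is downward continuity along `1/(n+1)`, together with monotonicity. At `t > 0`,
monotonicity of `f` and of `f(t)/t` squeezes `f(u)` between `min 1 (u/t) f(t)` and `max 1 (u/t)
f(t)`. -/
theorem continuous_repFun (hm : IsOperatorMean m) : Continuous (repFun m) := by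
  rw [continuous_iff_continuousAt]
  intro t
  rcases eq_or_ne t 0 with rfl | ht
  · have hdec : PosOp.Decreases (fun n : ℕ => PosOp.scalar H (1 / ((n : ℝ≥0) + 1)))
        (PosOp.scalar H 0) := by
      refine ⟨fun i j hij => PosOp.scalar_mono ?_,
        PosOp.tendstoSOT_scalar tendsto_one_div_add_atTop_nhds_zero_nat⟩
      exact one_div_le_one_div_of_le (by positivity) (by gcongr)
    have hconst : PosOp.Decreases (fun _ : ℕ => PosOp.scalar H 1) (PosOp.scalar H 1) :=
      ⟨fun _ _ _ => le_rfl, fun _ => tendsto_const_nhds⟩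
    have h := (hm.downward _ _ _ _ hconst hdec).2
    simp only [hm.one_scalar] at h
    have h1 := PosOp.tendsto_of_tendstoSOT_scalar h
    rw [ContinuousAt, tendsto_order]
    refine ⟨fun a ha => Eventually.of_forall fun x => ha.trans_le (hm.repFun_mono zero_le),
      fun a ha => ?_⟩
    obtain ⟨n, hn⟩ := (h1.eventually (gt_mem_nhds ha)).exists
    filter_upwards [gt_mem_nhds (show (0 : ℝ≥0) < 1 / ((n : ℝ≥0) + 1) by positivity)] with x hx
    exact (hm.repFun_mono hx.le).trans_lt hn
  · have htp := pos_iff_ne_zero.mpr ht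
    have hcont : ∀ g : ℝ≥0 → ℝ≥0, Continuous g → g t = 1 →
        Tendsto (fun u => g u * repFun m t) (𝓝 t) (𝓝 (repFun m t)) := fun g hg h1 => by
      have := (hg.mul_const (repFun m t)).tendsto t
      rwa [h1, one_mul] at this
    refine tendsto_of_tendsto_of_tendsto_of_le_of_le
      (hcont (fun u => min 1 (u / t)) (by fun_prop) (by simp [ht]))
      (hcont (fun u => max 1 (u / t)) (by fun_prop) (by simp [ht])) ?_ ?_
    · intro u
      change min 1 (u / t) * repFun m t ≤ repFun m u
      rcases le_total u t with h | h
      · refine (mul_le_mul_left (min_le_right _ _) _).trans ?_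
        rw [div_mul_eq_mul_div, div_le_iff₀ htp, mul_comm]
        exact hm.repFun_mul_le h
      · refine (mul_le_mul_left (min_le_left _ _) _).trans ?_
        rw [one_mul]; exact hm.repFun_mono h
    · intro u
      change repFun m u ≤ max 1 (u / t) * repFun m t
      rcases le_total u t with h | h
      · refine le_trans ?_ (mul_le_mul_left (le_max_left _ _) _)
        rw [one_mul]; exact hm.repFun_mono h
      · refine le_trans ?_ (mul_le_mul_left (le_max_right _ _) _)
        rw [div_mul_eq_mul_div, le_div_iff₀ htp, mul_comm u]
        exact hm.repFun_mul_le h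

end IsOperatorMean

end MeanBasics

/-! ### Spectral bands, and operator inequalities checked band by band. -/

section SpectralPartition

variable {H : Type*} [NormedAddCommGroup H] [InnerProductSpace ℂ H] [CompleteSpace H]

/-- The positive part of `A - t`. -/
noncomputable def upperPart (A : H →L[ℂ] H) (t : ℝ≥0) : H →L[ℂ] H :=
  cfc (fun x : ℝ≥0 => x - t) A

/-- The positive part of `t - A`. -/
noncomputable def lowerPart (A : H →L[ℂ] H) (t : ℝ≥0) : H →L[ℂ] H :=
  cfc (fun x : ℝ≥0 => t - x) A

theorem upperPart_nonneg (A : H →L[ℂ] H) (t : ℝ≥0) : 0 ≤ upperPart A t := cfc_nonneg_of_predicate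

theorem upperPart_mul_lowerPart (A : H →L[ℂ] H) (t : ℝ≥0) :
    upperPart A t * lowerPart A t = 0 := by
  rw [upperPart, lowerPart, ← cfc_mul ..]
  rw [cfc_congr (g := fun _ => 0) fun x _ => ?_, cfc_const_zero]
  rcases le_total x t with h | h
  · simp [tsub_eq_zero_of_le h]
  · simp [tsub_eq_zero_of_le h]

theorem lowerPart_zero (A : H →L[ℂ] H) : lowerPart A 0 = 0 := by
  simp [lowerPart]

theorem upperPart_anti (A : H →L[ℂ] H) {s t : ℝ≥0} (h : s ≤ t) :
    upperPart A t ≤ upperPart A s :=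
  cfc_mono fun _ _ => tsub_le_tsub_left h _

/-- Pointwise, `f(x) ≤ f(t) + (f(t)/t)(x - t)₊`. The correction term is annihilated by the spectral
band below `t`; `le_cfc_of_slope` is the counterpart from below. -/
theorem cfc_le_of_slope {f : ℝ≥0 → ℝ≥0} (hc : Continuous f) (hf : Monotone f)
    (hf' : ∀ t u, t ≤ u → f u * t ≤ f t * u) {A : H →L[ℂ] H} (hA : 0 ≤ A) {t : ℝ≥0} (ht : t ≠ 0) :
    cfc f A ≤ algebraMap ℝ≥0 _ (f t) + (f t / t) • upperPart A t := by
  rw [upperPart, ← cfc_const_mul .., ← cfc_const_add ..]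
  refine cfc_mono fun x _ => ?_
  rcases le_total x t with h | h
  · exact (hf h).trans le_self_add
  · have h1 := hf' t x h
    rw [← mul_le_mul_iff_left₀ (pos_iff_ne_zero.mpr ht)]
    refine h1.trans (le_of_eq ?_)
    rw [add_mul, mul_right_comm, div_mul_cancel₀ _ ht, ← mul_add, add_tsub_cancel_of_le h]

theorem le_cfc_of_slope {f : ℝ≥0 → ℝ≥0} (hc : Continuous f) (hf : Monotone f)
    (hf' : ∀ t u, t ≤ u → f u * t ≤ f t * u) {A : H →L[ℂ] H} (hA : 0 ≤ A) {s : ℝ≥0} (hs : s ≠ 0) :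
    algebraMap ℝ≥0 _ (f s) ≤ cfc f A + (f s / s) • lowerPart A s := by
  rw [lowerPart, ← cfc_const_mul .., ← cfc_add .., ← cfc_const (f s) A]
  refine cfc_mono fun x _ => ?_
  rcases le_total s x with h | h
  · exact (hf h).trans le_self_add
  · have h1 := hf' x s h
    rw [← mul_le_mul_iff_left₀ (pos_iff_ne_zero.mpr hs)]
    rw [add_mul, mul_right_comm, div_mul_cancel₀ _ hs, mul_tsub]
    refine le_trans ?_ (add_le_add_left h1 _)
    rw [add_tsub_cancel_of_le (mul_le_mul_right h _)]

theorem commute_starProjection_of_invariant {T : H →L[ℂ] H} (hT : IsSelfAdjoint T)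
    (U : Submodule ℂ H) [U.HasOrthogonalProjection] (h : ∀ x ∈ U, T x ∈ U) :
    Commute U.starProjection T := by
  have h1 : T * U.starProjection = U.starProjection * T * U.starProjection := by
    ext x
    exact (Submodule.starProjection_eq_self_iff.mpr
      (h _ (Submodule.starProjection_apply_mem U x))).symm
  have h3 := congrArg star h1
  have hP : star U.starProjection = U.starProjection :=
    (isStarProjection_starProjection (U := U)).isSelfAdjoint.star_eq
  simp only [star_mul, hT.star_eq, hP] at h3
  rw [Commute, SemiconjBy, h3, ← mul_assoc, ← h1]

/-- The spectral projection of `A` onto `(-∞, t]`, with the convention that it vanishes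
for `t = 0`. -/
noncomputable def specProj (A : H →L[ℂ] H) (t : ℝ≥0) : H →L[ℂ] H :=
  if t = 0 then 0 else (LinearMap.ker (upperPart A t : H →ₗ[ℂ] H)).starProjection

theorem isStarProjection_specProj (A : H →L[ℂ] H) (t : ℝ≥0) : IsStarProjection (specProj A t) := by
  unfold specProj
  split_ifs
  · exact IsStarProjection.zero _
  · exact isStarProjection_starProjection

theorem commute_specProj {A T : H →L[ℂ] H} (hT : IsSelfAdjoint T) (h : Commute A T) (t : ℝ≥0) :
    Commute (specProj A t) T := by
  unfold specProj
  split_ifs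
  · exact Commute.zero_left _
  · refine commute_starProjection_of_invariant hT _ fun x hx => ?_
    rw [LinearMap.mem_ker] at hx ⊢
    have h1 : upperPart A t * T = T * upperPart A t := h.cfc_nnreal _
    have h2 : upperPart A t (T x) = T (upperPart A t x) := congrArg (fun S => S x) h1
    change upperPart A t (T x) = 0
    rw [h2, show upperPart A t x = 0 from hx, map_zero]

theorem upperPart_mul_specProj (A : H →L[ℂ] H) (t : ℝ≥0) : upperPart A t * specProj A t = 0 := by
  unfold specProj
  split_ifs
  · exact mul_zero _
  · ext x
    exact (Submodule.starProjection_apply_mem (LinearMap.ker (upperPart A t : H →ₗ[ℂ] H)) x)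

/-- For `t ≠ 0`, the range of `(t - A)₊` lies in the kernel of `(A - t)₊` because their product
vanishes. -/
theorem specProj_mul_lowerPart (A : H →L[ℂ] H) (t : ℝ≥0) :
    specProj A t * lowerPart A t = lowerPart A t := by
  rcases eq_or_ne t 0 with rfl | ht
  · simp [lowerPart_zero]
  · rw [specProj, if_neg ht]
    ext x
    refine Submodule.starProjection_eq_self_iff.mpr ?_
    exact congrArg (fun S => S x) (upperPart_mul_lowerPart A t)

theorem specProj_mul_specProj {A : H →L[ℂ] H} {s t : ℝ≥0} (h : s ≤ t) :
    specProj A t * specProj A s = specProj A s := by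
  rcases eq_or_ne s 0 with rfl | hs
  · simp [specProj]
  have ht : t ≠ 0 := ((pos_iff_ne_zero.mpr hs).trans_le h).ne'
  have hP := isStarProjection_specProj A s
  have h0 : upperPart A t * specProj A s = 0 := by
    apply mul_eq_zero_of_conj_eq_zero (upperPart_nonneg A t) hP.isSelfAdjoint
    refine le_antisymm ?_ (hP.isSelfAdjoint.conjugate_nonneg (upperPart_nonneg A t))
    refine (IsSelfAdjoint.conjugate_le_conjugate (upperPart_anti A h) hP.isSelfAdjoint).trans ?_
    rw [mul_assoc, upperPart_mul_specProj, mul_zero]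
  ext x
  rw [specProj, if_neg ht]
  refine Submodule.starProjection_eq_self_iff.mpr ?_
  exact congrArg (fun S => S x) h0

theorem specProj_of_norm_le {A : H →L[ℂ] H} {t : ℝ≥0} (ht : t ≠ 0) (h : ‖A‖₊ ≤ t) :
    specProj A t = 1 := by
  have h0 : upperPart A t = 0 := by
    rw [upperPart, cfc_congr (g := fun _ => 0) fun x hx => ?_, cfc_const_zero]
    refine tsub_eq_zero_of_le (le_trans ?_ h)
    by_cases hn : Nontrivial H
    · have hx' : (x : ℝ) ∈ spectrum ℝ A :=
        (spectrum.algebraMap_mem_iff ℝ (R := ℝ≥0)).mpr hx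
      have := spectrum.norm_le_norm_of_mem hx'
      rw [Real.norm_of_nonneg x.coe_nonneg] at this
      exact_mod_cast this
    · rw [not_nontrivial_iff_subsingleton] at hn
      have : Subsingleton (H →L[ℂ] H) := ⟨fun a b => ContinuousLinearMap.ext fun x =>
        Subsingleton.elim _ _⟩
      simp [spectrum.of_subsingleton] at hx
  rw [specProj, if_neg ht]
  ext x
  refine Submodule.starProjection_eq_self_iff.mpr ?_
  exact congrArg (fun S : H →L[ℂ] H => S x) h0

/-- The spectral projection of `A` onto `(s, t]`. -/
noncomputable def specBand (A : H →L[ℂ] H) (s t : ℝ≥0) : H →L[ℂ] H := specProj A t - specProj A s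

theorem isStarProjection_specBand {A : H →L[ℂ] H} {s t : ℝ≥0} (h : s ≤ t) :
    IsStarProjection (specBand A s t) :=
  ((isStarProjection_specProj A s).le_iff_sub (isStarProjection_specProj A t)).mp
    ((isStarProjection_specProj A s).le_of_mul_eq_right (isStarProjection_specProj A t)
      (specProj_mul_specProj h))

theorem commute_specBand {A T : H →L[ℂ] H} (hT : IsSelfAdjoint T) (h : Commute A T) (s t : ℝ≥0) :
    Commute (specBand A s t) T :=
  (commute_specProj hT h t).sub_left (commute_specProj hT h s)

theorem upperPart_mul_specBand (A : H →L[ℂ] H) {s t : ℝ≥0} (h : s ≤ t) :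
    upperPart A t * specBand A s t = 0 := by
  rw [specBand, mul_sub, upperPart_mul_specProj, ← specProj_mul_specProj h, ← mul_assoc,
    upperPart_mul_specProj, zero_mul, sub_zero]

theorem specBand_mul_lowerPart (A : H →L[ℂ] H) {s t : ℝ≥0} (h : s ≤ t) :
    specBand A s t * lowerPart A s = 0 := by
  rw [specBand, sub_mul, specProj_mul_lowerPart A]
  nth_rewrite 1 [← specProj_mul_lowerPart A s]
  rw [← mul_assoc, specProj_mul_specProj h, specProj_mul_lowerPart A, sub_self]

/-- The sum telescopes to `1` because `specProj A 0` is `0` by convention; for positive `A` the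
first band thus contains the kernel of `A`. -/
theorem sum_specBand {A : H →L[ℂ] H} {δ : ℝ≥0} {n : ℕ} (hδ : n * δ ≠ 0)
    (h : ‖A‖₊ ≤ n * δ) :
    ∑ i ∈ Finset.range n, specBand A (i * δ) ((i + 1 : ℕ) * δ) = 1 := by
  unfold specBand
  rw [Finset.sum_range_sub (fun i : ℕ => specProj A (i * δ)), specProj_of_norm_le hδ h]
  simp [specProj]

theorem conj_cfc_le {f : ℝ≥0 → ℝ≥0} (hc : Continuous f) (hf : Monotone f)
    (hf' : ∀ t u, t ≤ u → f u * t ≤ f t * u) {A : H →L[ℂ] H} (hA : 0 ≤ A) {s t : ℝ≥0} (ht : t ≠ 0)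
    (h : s ≤ t) :
    specBand A s t * cfc f A * specBand A s t ≤
      specBand A s t * algebraMap ℝ≥0 _ (f t) * specBand A s t := by
  have hE := isStarProjection_specBand (A := A) h
  refine (IsSelfAdjoint.conjugate_le_conjugate (cfc_le_of_slope hc hf hf' hA ht)
    hE.isSelfAdjoint).trans (le_of_eq ?_)
  rw [mul_add, add_mul, mul_smul_comm, smul_mul_assoc, mul_assoc _ (upperPart A t),
    upperPart_mul_specBand A h, mul_zero, smul_zero, add_zero]

theorem le_conj_cfc {f : ℝ≥0 → ℝ≥0} (hc : Continuous f) (hf : Monotone f)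
    (hf' : ∀ t u, t ≤ u → f u * t ≤ f t * u) {A : H →L[ℂ] H} (hA : 0 ≤ A) {s t : ℝ≥0}
    (h : s ≤ t) :
    specBand A s t * algebraMap ℝ≥0 _ (f s) * specBand A s t ≤
      specBand A s t * cfc f A * specBand A s t := by
  have hE := isStarProjection_specBand (A := A) h
  rcases eq_or_ne s 0 with rfl | hs
  · refine IsSelfAdjoint.conjugate_le_conjugate ?_ hE.isSelfAdjoint
    rw [← cfc_const (f 0) A]
    exact cfc_mono fun x _ => hf (zero_le)
  refine (IsSelfAdjoint.conjugate_le_conjugate (le_cfc_of_slope hc hf hf' hA hs)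
    hE.isSelfAdjoint).trans (le_of_eq ?_)
  rw [mul_add, add_mul, mul_smul_comm, smul_mul_assoc,
    specBand_mul_lowerPart A h, zero_mul, smul_zero, add_zero]

theorem conj_specBand_le {A : H →L[ℂ] H} (hA : 0 ≤ A) {s t : ℝ≥0} (h : s ≤ t) :
    specBand A s t * A * specBand A s t ≤
      specBand A s t * algebraMap ℝ≥0 _ t * specBand A s t := by
  rcases eq_or_ne t 0 with rfl | ht
  · simp [specBand, specProj, le_antisymm h zero_le]
  have := conj_cfc_le (f := fun x => x) continuous_id monotone_id
    (fun t u _ => (mul_comm u t).le) hA ht h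
  rwa [cfc_id' ℝ≥0 A] at this

theorem le_conj_specBand {A : H →L[ℂ] H} (hA : 0 ≤ A) {s t : ℝ≥0} (h : s ≤ t) :
    specBand A s t * algebraMap ℝ≥0 _ s * specBand A s t ≤
      specBand A s t * A * specBand A s t := by
  have := le_conj_cfc (f := fun x => x) continuous_id monotone_id
    (fun t u _ => (mul_comm u t).le) hA h
  rwa [cfc_id' ℝ≥0 A] at this

/-- Operators commuting with all `E i` are block diagonal, so their order can be tested on each
block. -/
theorem le_of_sum_projections {ι : Type*} (S : Finset ι) (E : ι → H →L[ℂ] H)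
    (hE : ∀ i ∈ S, IsStarProjection (E i)) (hsum : ∑ i ∈ S, E i = 1) {Y Z : H →L[ℂ] H}
    (hY : ∀ i ∈ S, Commute (E i) Y) (hZ : ∀ i ∈ S, Commute (E i) Z)
    (h : ∀ i ∈ S, E i * Y * E i ≤ E i * Z * E i) : Y ≤ Z := by
  have key : ∀ W : H →L[ℂ] H, (∀ i ∈ S, Commute (E i) W) → W = ∑ i ∈ S, E i * W * E i := by
    intro W hW
    calc W = ∑ i ∈ S, E i * W := by rw [← Finset.sum_mul, hsum, one_mul]
      _ = _ := Finset.sum_congr rfl fun i hi => by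
        rw [mul_assoc, ← (hW i hi).eq, ← mul_assoc, (hE i hi).isIdempotentElem.eq]
  rw [key Y hY, key Z hZ]
  exact Finset.sum_le_sum h

theorem le_of_forall_le_add {Y Z : H →L[ℂ] H}
    (h : ∀ ε : ℝ≥0, 0 < ε → Y ≤ Z + algebraMap ℝ≥0 _ ε) : Y ≤ Z := by
  have h1 : Tendsto (fun n : ℕ => Z + algebraMap ℝ≥0 (H →L[ℂ] H) (1 / ((n : ℝ≥0) + 1)))
      atTop (𝓝 (Z + algebraMap ℝ≥0 (H →L[ℂ] H) 0)) :=
    (((continuous_algebraMap ℝ≥0 (H →L[ℂ] H)).tendsto 0).comp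
      tendsto_one_div_add_atTop_nhds_zero_nat).const_add Z
  rw [map_zero, add_zero] at h1
  exact ge_of_tendsto' h1 fun n => h _ (by positivity)

/-- On sufficiently short bands `f` varies by at most `ε`, by uniform continuity on a compact
interval. The band estimates then give `Y ≤ Z + ε`, and `ε` is arbitrary. -/
theorem le_of_specBand {f : ℝ≥0 → ℝ≥0} (hc : Continuous f) {A : H →L[ℂ] H}
    {Y Z : H →L[ℂ] H} (hY : ∀ s t : ℝ≥0, s ≤ t → Commute (specBand A s t) Y)
    (hZ : ∀ s t : ℝ≥0, s ≤ t → Commute (specBand A s t) Z)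
    (hYle : ∀ s t : ℝ≥0, s ≤ t → t ≠ 0 → specBand A s t * Y * specBand A s t ≤
      specBand A s t * algebraMap ℝ≥0 _ (f t) * specBand A s t)
    (hleZ : ∀ s t : ℝ≥0, s ≤ t → specBand A s t * algebraMap ℝ≥0 _ (f s) * specBand A s t ≤
      specBand A s t * Z * specBand A s t) : Y ≤ Z := by
  refine le_of_forall_le_add fun ε hε => ?_
  have huc := (isCompact_Icc (a := (0 : ℝ≥0)) (b := ‖A‖₊ + 1)).uniformContinuousOn_of_continuous
    hc.continuousOn
  rw [Metric.uniformContinuousOn_iff] at huc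
  obtain ⟨d, hd, hdist⟩ := huc ε (by exact_mod_cast hε)
  -- The added `1` keeps the total length, and so the band width, positive even if `A = 0`.
  set K : ℝ≥0 := ‖A‖₊ + 1 with hK
  have hKpos : 0 < K := by positivity
  obtain ⟨n, hn⟩ := exists_nat_gt ((K : ℝ) / d)
  have hn0 : 0 < n := by
    have : (0 : ℝ) < n := lt_of_le_of_lt (by positivity) hn
    exact_mod_cast this
  obtain ⟨δ, hδ⟩ : ∃ δ : ℝ≥0, δ = K / n := ⟨_, rfl⟩
  have hδpos : 0 < δ := by rw [hδ]; positivity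
  have hnδ : n * δ = K := by rw [hδ]; field_simp
  have hδd : (δ : ℝ) < d := by
    rw [hδ, NNReal.coe_div, NNReal.coe_natCast, div_lt_iff₀ (by exact_mod_cast hn0)]
    rwa [div_lt_iff₀ hd, mul_comm] at hn
  have hst : ∀ i : ℕ, (i : ℝ≥0) * δ ≤ ((i + 1 : ℕ) : ℝ≥0) * δ := fun i => by
    gcongr; simp
  have hstep : ∀ i ∈ Finset.range n, f ((i + 1 : ℕ) * δ) ≤ f (i * δ) + ε := by
    intro i hi
    have h1 : ((i + 1 : ℕ) : ℝ≥0) * δ ≤ K := by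
      rw [← hnδ]; gcongr; exact_mod_cast Finset.mem_range.mp hi
    have h2 := hdist _ ⟨zero_le, h1⟩ (i * δ) ⟨zero_le, (hst i).trans h1⟩ (by
      rw [NNReal.dist_eq]; push_cast
      rw [add_mul, one_mul, add_sub_cancel_left, abs_of_nonneg (NNReal.coe_nonneg δ)]; exact hδd)
    rw [NNReal.dist_eq, abs_lt] at h2
    rw [← NNReal.coe_le_coe]; push_cast at h2 ⊢; linarith
  refine le_of_sum_projections _ (fun i : ℕ => specBand A (i * δ) ((i + 1 : ℕ) * δ))
    (fun i _ => isStarProjection_specBand (hst i))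
    (sum_specBand (by rw [hnδ]; exact hKpos.ne') (by rw [hnδ, hK]; exact le_self_add))
    (fun i _ => hY _ _ (hst i))
    (fun i _ => (hZ _ _ (hst i)).add_right (Algebra.commutes ε _).symm) fun i hi => ?_
  have hE := isStarProjection_specBand (A := A) (hst i)
  refine (hYle _ _ (hst i) (by positivity)).trans ?_
  refine (IsSelfAdjoint.conjugate_le_conjugate (algebraMap_mono (H →L[ℂ] H) (hstep i hi))
    hE.isSelfAdjoint).trans ?_
  rw [map_add, mul_add, add_mul, mul_add, add_mul]
  gcongr ?_ + _
  exact hleZ _ _ (hst i)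

end SpectralPartition

/-! ### The functional calculus formula for a mean. -/

section RepresentingFunction

variable {H : Type*} [NormedAddCommGroup H] [InnerProductSpace ℂ H] [CompleteSpace H]
  {m : PosOp H → PosOp H → PosOp H} [Nontrivial H]

namespace IsOperatorMean

theorem conj_one_left_le (hm : IsOperatorMean m) {E A : PosOp H} (hE : IsStarProjection E.1)
    (hA : Commute E.1 A.1) {t : ℝ≥0} (h : E.conj A ≤ E.conj (PosOp.scalar H t)) :
    E.conj (m (PosOp.scalar H 1) A) ≤ E.conj (PosOp.scalar H (repFun m t)) := by
  rw [← hm.conj_conj_eq hE (PosOp.commute_scalar _ _) hA, ← hm.one_scalar,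
    ← hm.conj_conj_eq hE (PosOp.commute_scalar _ _) (PosOp.commute_scalar _ _)]
  exact E.conj_mono (hm.mono _ _ _ _ le_rfl h)

theorem le_conj_one_left (hm : IsOperatorMean m) {E A : PosOp H} (hE : IsStarProjection E.1)
    (hA : Commute E.1 A.1) {t : ℝ≥0} (h : E.conj (PosOp.scalar H t) ≤ E.conj A) :
    E.conj (PosOp.scalar H (repFun m t)) ≤ E.conj (m (PosOp.scalar H 1) A) := by
  rw [← hm.conj_conj_eq hE (PosOp.commute_scalar _ _) hA, ← hm.one_scalar,
    ← hm.conj_conj_eq hE (PosOp.commute_scalar _ _) (PosOp.commute_scalar _ _)]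
  exact E.conj_mono (hm.mono _ _ _ _ le_rfl h)

/-- On the band `(s, t]` both sides lie between `f(s)` and `f(t)`: the mean by localisation, `f(A)`
by the slope estimates. Each inequality is then an instance of `le_of_specBand`. -/
theorem one_left (hm : IsOperatorMean m) (A : PosOp H) :
    (m (PosOp.scalar H 1) A).1 = cfc (repFun m) A.1 := by
  have hc := hm.continuous_repFun
  have hslope : ∀ t u, t ≤ u → repFun m u * t ≤ repFun m t * u := fun t u => hm.repFun_mul_le
  have hEA : ∀ s t : ℝ≥0, Commute (specBand A.1 s t) A.1 := fun s t =>
    commute_specBand A.isSelfAdjoint (Commute.refl _) _ _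
  have hEZ : ∀ s t : ℝ≥0, s ≤ t → Commute (specBand A.1 s t) (cfc (repFun m) A.1) := fun s t _ =>
    ((hEA s t).symm.cfc_nnreal _).symm
  have hEY : ∀ s t : ℝ≥0, s ≤ t → Commute (specBand A.1 s t) (m (PosOp.scalar H 1) A).1 :=
    fun s t h => hm.commute_of_commute
      (P := ⟨specBand A.1 s t, (isStarProjection_specBand h).nonneg⟩)
      (isStarProjection_specBand h) (PosOp.commute_scalar _ _) (hEA s t)
  apply le_antisymm
  · refine le_of_specBand hc hEY hEZ (fun s t h _ => ?_)
      (fun s t h => le_conj_cfc hc hm.repFun_mono hslope A.2 h)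
    exact hm.conj_one_left_le (E := ⟨specBand A.1 s t, (isStarProjection_specBand h).nonneg⟩)
      (isStarProjection_specBand h) (hEA s t) (conj_specBand_le A.2 h)
  · refine le_of_specBand hc hEZ hEY
      (fun s t h ht => conj_cfc_le hc hm.repFun_mono hslope A.2 ht h) (fun s t h => ?_)
    exact hm.le_conj_one_left (E := ⟨specBand A.1 s t, (isStarProjection_specBand h).nonneg⟩)
      (isStarProjection_specBand h) (hEA s t) (le_conj_specBand A.2 h)

end IsOperatorMean

/-- The real power `A ^ y` as a positive operator. -/
noncomputable def PosOp.rpow (A : PosOp H) (y : ℝ) : PosOp H := ⟨A.1 ^ y, CFC.rpow_nonneg⟩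

omit [Nontrivial H] in
theorem PosOp.Inv.isStrictlyPositive {A : PosOp H} (hA : A.Inv) : IsStrictlyPositive A.1 :=
  ⟨A.2, hA⟩

omit [Nontrivial H] in
theorem PosOp.Inv.rpow_mul_rpow {A : PosOp H} (hA : A.Inv) {x y : ℝ} (h : x + y = 0) :
    (A.rpow x).1 * (A.rpow y).1 = 1 := by
  change A.1 ^ x * A.1 ^ y = 1
  rw [← CFC.rpow_add hA, h, CFC.rpow_zero A.1 A.2]

omit [Nontrivial H] in
theorem PosOp.Inv.conj_rpow_one {A : PosOp H} (hA : A.Inv) :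
    (A.rpow (1 / 2)).conj (scalar H 1) = A := by
  apply Subtype.ext
  rw [coe_conj, scalar_one, mul_one]
  change A.1 ^ (1 / 2 : ℝ) * A.1 ^ (1 / 2 : ℝ) = A.1
  rw [← CFC.rpow_add hA, add_halves, CFC.rpow_one A.1 A.2]

omit [Nontrivial H] in
theorem IsOperatorMean.eq_conj_one_left (hm : IsOperatorMean m) {A : PosOp H} (hA : A.Inv)
    (B : PosOp H) : m A B =
      (A.rpow (1 / 2)).conj (m (PosOp.scalar H 1) ((A.rpow (-(1 / 2))).conj B)) := by
  have h1 := hA.rpow_mul_rpow (x := 1 / 2) (y := -(1 / 2)) (by ring)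
  have h2 := hA.rpow_mul_rpow (x := -(1 / 2)) (y := 1 / 2) (by ring)
  rw [hm.conj_eq h1 h2, PosOp.conj_conj_cancel h1 h2, hA.conj_rpow_one]

theorem IsOperatorMean.isRepresentingFunction (hm : IsOperatorMean m) :
    IsRepresentingFunction m (repFun m) where
  continuous := hm.continuous_repFun
  operatorMonotone A B h := by
    rw [← hm.one_left, ← hm.one_left]
    exact hm.mono _ _ _ _ le_rfl h
  map_one := hm.repFun_one
  formula A B hA _ := by
    rw [hm.eq_conj_one_left hA, PosOp.coe_conj, hm.one_left]
    rfl

end RepresentingFunction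

/-! ### Strict monotonicity of the representing function away from the left mean. -/

section StrictMonotonicity

variable {H : Type*} [NormedAddCommGroup H] [InnerProductSpace ℂ H] [CompleteSpace H]
  {m : PosOp H → PosOp H → PosOp H}

theorem PosOp.le_iff_re_inner {A B : H →L[ℂ] H} (hA : IsSelfAdjoint A) (hB : IsSelfAdjoint B) :
    A ≤ B ↔ ∀ x : H, (inner ℂ (A x) x).re ≤ (inner ℂ (B x) x).re := by
  rw [ContinuousLinearMap.le_def, ContinuousLinearMap.isPositive_def']
  have hs : IsSelfAdjoint (B - A) := hB.sub hA
  simp only [hs, true_and, ContinuousLinearMap.reApplyInnerSelf_apply, sub_apply, inner_sub_left]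
  refine forall_congr' fun x => ?_
  rw [map_sub, sub_nonneg]
  rfl

theorem PosOp.proj_apply {ξ : H} (hξ : ‖ξ‖ = 1) (x : H) :
    (PosOp.proj (ℂ ∙ ξ)).1 x = inner ℂ ξ x • ξ :=
  Submodule.starProjection_unit_singleton ℂ hξ x

/-- The positive operator `s P + u (1 - P)` for a projection `P`. -/
noncomputable def PosOp.twoValued (P : PosOp H) (hP : IsStarProjection P.1) (s u : ℝ≥0) : PosOp H :=
  ⟨(s : ℝ) • P.1 + (u : ℝ) • (1 - P.1), add_nonneg (smul_nonneg s.2 P.2)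
    (smul_nonneg u.2 hP.one_sub.nonneg)⟩

theorem PosOp.conj_scalar_of_proj {P : PosOp H} (hP : IsStarProjection P.1) (t : ℝ≥0) :
    (P.conj (PosOp.scalar H t)).1 = (t : ℝ) • P.1 := by
  rw [PosOp.coe_conj, PosOp.coe_scalar, mul_smul_comm, mul_one, smul_mul_assoc,
    hP.isIdempotentElem.eq]

theorem PosOp.inv_add_scalar (A : PosOp H) {ε : ℝ≥0} (hε : 0 < ε) : (A + PosOp.scalar H ε).Inv :=
  (IsStrictlyPositive.nonneg_add A.2 (PosOp.scalar_inv hε.ne').isStrictlyPositive).isUnit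

theorem PosOp.add_scalar_mono {A B : PosOp H} (h : A ≤ B) {ε δ : ℝ≥0} (hε : ε ≤ δ) :
    A + PosOp.scalar H ε ≤ B + PosOp.scalar H δ :=
  add_le_add (α := H →L[ℂ] H) h (PosOp.scalar_mono hε)

theorem PosOp.decreases_add_scalar (A : PosOp H) :
    PosOp.Decreases (fun n : ℕ => A + PosOp.scalar H (1 / ((n : ℝ≥0) + 1))) A := by
  refine ⟨fun i j hij => PosOp.add_scalar_mono le_rfl ?_, fun ξ => ?_⟩
  · exact one_div_le_one_div_of_le (by positivity) (by gcongr)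
  · have h := (PosOp.tendstoSOT_scalar (H := H)
      tendsto_one_div_add_atTop_nhds_zero_nat ξ).const_add (A.1 ξ)
    simpa [PosOp.coe_scalar, PosOp.coe_add] using h

namespace IsOperatorMean

variable [Nontrivial H]

theorem conj_one_left_eq (hm : IsOperatorMean m) {E A : PosOp H} (hE : IsStarProjection E.1)
    (hA : Commute E.1 A.1) {t : ℝ≥0} (h : E.conj A = E.conj (PosOp.scalar H t)) :
    E.conj (m (PosOp.scalar H 1) A) = E.conj (PosOp.scalar H (repFun m t)) :=
  le_antisymm (hm.conj_one_left_le hE hA h.le) (hm.le_conj_one_left hE hA h.ge)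

/-- Localisation to `P` and to `1 - P` determines the two diagonal blocks, and the mean commutes
with `P`. -/
theorem one_left_twoValued (hm : IsOperatorMean m) (P : PosOp H) (hP : IsStarProjection P.1)
    (s u : ℝ≥0) : m (PosOp.scalar H 1) (PosOp.twoValued P hP s u) =
      PosOp.twoValued P hP (repFun m s) (repFun m u) := by
  let P' : PosOp H := ⟨1 - P.1, hP.one_sub.nonneg⟩
  have hP' : IsStarProjection P'.1 := hP.one_sub
  have hPP : P.1 * P.1 = P.1 := hP.isIdempotentElem
  have hc : Commute P.1 (PosOp.twoValued P hP s u).1 :=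
    ((Commute.refl _).smul_right _).add_right
      (((Commute.one_right _).sub_right (Commute.refl _)).smul_right _)
  have hc' : Commute P'.1 (PosOp.twoValued P hP s u).1 := (Commute.one_left _).sub_left hc
  have h1 := hm.conj_one_left_eq hP hc (t := s) (by
    apply Subtype.ext
    rw [PosOp.conj_scalar_of_proj hP, PosOp.coe_conj]
    simp [PosOp.twoValued, mul_add, mul_sub, hPP])
  have h2 := hm.conj_one_left_eq hP' hc' (t := u) (by
    apply Subtype.ext
    rw [PosOp.conj_scalar_of_proj hP', PosOp.coe_conj]
    simp [PosOp.twoValued, P', mul_add, mul_sub, sub_mul, hPP])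
  have hY := hm.commute_of_commute hP (PosOp.commute_scalar _ 1) hc
  set Y := m (PosOp.scalar H 1) (PosOp.twoValued P hP s u)
  have h1' := congrArg Subtype.val h1
  have h2' := congrArg Subtype.val h2
  rw [PosOp.conj_scalar_of_proj hP, PosOp.coe_conj, mul_assoc, ← hY.eq, ← mul_assoc, hPP] at h1'
  have hY' : Commute P'.1 Y.1 := (Commute.one_left _).sub_left hY
  rw [PosOp.conj_scalar_of_proj hP', PosOp.coe_conj, mul_assoc, ← hY'.eq, ← mul_assoc,
    hP'.isIdempotentElem.eq] at h2'
  apply Subtype.ext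
  change Y.1 = (repFun m s : ℝ) • P.1 + (repFun m u : ℝ) • P'.1
  rw [← h1', ← h2', ← add_mul]
  simp [P']

/-- A Jensen inequality: compressing to the line of `ξ` turns `A` into the number `v`, and the
transformer inequality compares the compressed mean with `f(v)`. -/
theorem re_inner_one_left_le (hm : IsOperatorMean m) (A : PosOp H) {ξ : H} (hξ : ‖ξ‖ = 1)
    {v : ℝ≥0} (hv : inner ℂ ξ (A.1 ξ) = ((v : ℝ) : ℂ)) :
    (inner ℂ ((m (PosOp.scalar H 1) A).1 ξ) ξ).re ≤ repFun m v := by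
  set Q := PosOp.proj (ℂ ∙ ξ) with hQ
  have hQp : IsStarProjection Q.1 := PosOp.isStarProjection_proj _
  have hQξ : Q.1 ξ = ξ := by
    rw [PosOp.proj_apply hξ, inner_self_eq_norm_sq_to_K, hξ]; simp
  have h1 : Q.conj A = Q.conj (PosOp.scalar H v) := by
    apply Subtype.ext
    rw [PosOp.conj_scalar_of_proj hQp]
    ext x
    change Q.1 (A.1 (Q.1 x)) = (v : ℝ) • Q.1 x
    rw [PosOp.proj_apply hξ x, map_smul, map_smul, PosOp.proj_apply hξ, hv, smul_smul,
      ← Complex.coe_smul (v : ℝ), smul_smul, mul_comm]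
  have h2 : Q.conj (m (PosOp.scalar H 1) A) ≤
      m (Q.conj (PosOp.scalar H 1)) (Q.conj (PosOp.scalar H v)) := h1 ▸ hm.transformer _ _ Q
  -- A second compression lets localisation replace `Q` and `v Q` by `I` and `v I`.
  have h3 := Q.conj_mono h2
  rw [hm.conj_conj_eq hQp (PosOp.commute_scalar _ _) (PosOp.commute_scalar _ _),
    hm.one_scalar] at h3
  have h4 := (PosOp.le_iff_re_inner (PosOp.isSelfAdjoint _) (PosOp.isSelfAdjoint _)).mp h3 ξ
  rw [PosOp.conj_scalar_of_proj hQp] at h4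
  have h5 : (Q.conj (Q.conj (m (PosOp.scalar H 1) A))).1 ξ =
      Q.1 ((m (PosOp.scalar H 1) A).1 ξ) := by
    change Q.1 (Q.1 ((m (PosOp.scalar H 1) A).1 (Q.1 (Q.1 ξ)))) = _
    rw [hQξ, hQξ]
    exact congrArg (fun T : H →L[ℂ] H => T _) hQp.isIdempotentElem.eq
  have h6 : inner ℂ (Q.1 ((m (PosOp.scalar H 1) A).1 ξ)) ξ =
      inner ℂ ((m (PosOp.scalar H 1) A).1 ξ) ξ := by
    refine (Submodule.inner_starProjection_left_eq_right (ℂ ∙ ξ) _ ξ).trans ?_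
    exact congrArg _ hQξ
  rw [h5, h6, smul_apply, hQξ, ← Complex.coe_smul, inner_smul_left,
    inner_self_eq_norm_sq_to_K, hξ] at h4
  simpa using h4

theorem smul_proj_le_one_left (hm : IsOperatorMean m) {Q A : PosOp H} (hQ : IsStarProjection Q.1)
    {r : ℝ≥0} (h : (r : ℝ) • Q.1 ≤ A.1) :
    (repFun m r : ℝ) • Q.1 ≤ (m (PosOp.scalar H 1) A).1 := by
  have hc : Commute Q.1 (Q.conj (PosOp.scalar H r)).1 := by
    rw [PosOp.conj_scalar_of_proj hQ]; exact (Commute.refl _).smul_right _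
  have h0 : Q.conj (Q.conj (PosOp.scalar H r)) = Q.conj (PosOp.scalar H r) := by
    apply Subtype.ext
    rw [PosOp.coe_conj, PosOp.conj_scalar_of_proj hQ]
    simp [hQ.isIdempotentElem.eq]
  have h1 := hm.le_conj_one_left hQ hc h0.ge
  have h2 : Q.conj (m (PosOp.scalar H 1) (Q.conj (PosOp.scalar H r))) ≤
      m (PosOp.scalar H 1) (Q.conj (PosOp.scalar H r)) :=
    conj_le_self_of_commute hQ (Subtype.prop _)
      (hm.commute_of_commute hQ (PosOp.commute_scalar _ _) hc)
  have h3 := hm.mono _ _ _ _ (le_refl (PosOp.scalar H 1))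
    (show Q.conj (PosOp.scalar H r) ≤ A by
      change (Q.conj (PosOp.scalar H r)).1 ≤ A.1
      rwa [PosOp.conj_scalar_of_proj hQ])
  rw [← PosOp.conj_scalar_of_proj hQ]
  exact h1.trans (h2.trans h3)

end IsOperatorMean

theorem PosOp.twoValued_apply {e₁ e₂ : H} (h₁ : ‖e₁‖ = 1) (h₁₂ : inner ℂ e₁ e₂ = 0)
    (s u : ℝ≥0) (x y : ℂ) :
    (PosOp.twoValued _ (PosOp.isStarProjection_proj (ℂ ∙ e₁)) s u).1 (x • e₁ + y • e₂) =
      (((s : ℝ) : ℂ) * x) • e₁ + (((u : ℝ) : ℂ) * y) • e₂ := by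
  have h : (PosOp.proj (ℂ ∙ e₁)).1 (x • e₁ + y • e₂) = x • e₁ := by
    rw [PosOp.proj_apply h₁, inner_add_right, inner_smul_right, inner_smul_right, h₁₂,
      inner_self_eq_norm_sq_to_K, h₁]
    simp
  simp only [PosOp.twoValued, add_apply, smul_apply, sub_apply, one_apply_eq_self, h,
    add_sub_cancel_left, ← Complex.coe_smul, smul_smul]

theorem PosOp.re_inner_proj {ξ : H} (hξ : ‖ξ‖ = 1) (x : H) :
    (inner ℂ ((PosOp.proj (ℂ ∙ ξ)).1 x) x).re = ‖inner ℂ ξ x‖ ^ 2 := by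
  rw [PosOp.proj_apply hξ, inner_smul_left, ← Complex.normSq_eq_conj_mul_self, Complex.ofReal_re,
    Complex.normSq_eq_norm_sq]

omit [CompleteSpace H] in
theorem inner_pair {e₁ e₂ : H} (h₁ : ‖e₁‖ = 1) (h₂ : ‖e₂‖ = 1) (h₁₂ : inner ℂ e₁ e₂ = 0)
    (x y x' y' : ℂ) : inner ℂ (x • e₁ + y • e₂) (x' • e₁ + y' • e₂) =
      (starRingEnd ℂ) x * x' + (starRingEnd ℂ) y * y' := by
  have h₂₁ : inner ℂ e₂ e₁ = 0 := inner_eq_zero_symm.mp h₁₂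
  simp only [inner_add_left, inner_add_right, inner_smul_left, inner_smul_right, h₁₂, h₂₁,
    inner_self_eq_norm_sq_to_K, h₁, h₂]
  simp [mul_comm]

omit [CompleteSpace H] in
theorem norm_pair {e₁ e₂ : H} (h₁ : ‖e₁‖ = 1) (h₂ : ‖e₂‖ = 1) (h₁₂ : inner ℂ e₁ e₂ = 0)
    {l k : ℝ≥0} (hlk : l + k = 1) : ‖(√(l : ℝ) : ℂ) • e₁ + (√(k : ℝ) : ℂ) • e₂‖ = 1 := by
  have h := inner_pair h₁ h₂ h₁₂ (√(l : ℝ) : ℂ) (√(k : ℝ) : ℂ) (√(l : ℝ) : ℂ) (√(k : ℝ) : ℂ)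
  rw [Complex.conj_ofReal, Complex.conj_ofReal, ← Complex.ofReal_mul, ← Complex.ofReal_mul,
    Real.mul_self_sqrt l.coe_nonneg, Real.mul_self_sqrt k.coe_nonneg, ← Complex.ofReal_add,
    ← NNReal.coe_add, hlk] at h
  have h' : ‖(√(l : ℝ) : ℂ) • e₁ + (√(k : ℝ) : ℂ) • e₂‖ ^ 2 = 1 := by
    rw [← inner_self_eq_norm_sq (𝕜 := ℂ), h]; simp
  exact (pow_eq_one_iff_of_nonneg (norm_nonneg _) two_ne_zero).mp h'

omit [CompleteSpace H] in
theorem norm_sq_inner_pair_le {e₁ e₂ : H} (h₁ : ‖e₁‖ = 1) (h₂ : ‖e₂‖ = 1)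
    (h₁₂ : inner ℂ e₁ e₂ = 0) (x : H) :
    ‖inner ℂ e₁ x‖ ^ 2 + ‖inner ℂ e₂ x‖ ^ 2 ≤ ‖x‖ ^ 2 := by
  have ho : Orthonormal ℂ ![e₁, e₂] := by
    rw [orthonormal_iff_ite]
    intro i j
    fin_cases i <;> fin_cases j <;>
      simp [h₁₂, inner_eq_zero_symm.mp h₁₂, inner_self_eq_norm_sq_to_K, h₁, h₂]
  simpa using ho.sum_inner_products_le x (s := Finset.univ)

omit [CompleteSpace H] in
-- Two orthonormal vectors are all that the convexity arguments below need of infinite dimension.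
theorem exists_orthonormal_pair (hH : ¬ FiniteDimensional ℂ H) :
    ∃ e₁ e₂ : H, ‖e₁‖ = 1 ∧ ‖e₂‖ = 1 ∧ inner ℂ e₁ e₂ = 0 := by
  have unit : ∀ v : H, v ≠ 0 → ‖(((‖v‖ : ℝ) : ℂ)⁻¹) • v‖ = 1 := fun v hv => by
    rw [norm_smul, norm_inv, Complex.norm_real, norm_norm, inv_mul_cancel₀ (norm_ne_zero_iff.mpr hv)]
  have hn : ∃ v : H, v ≠ 0 := by
    by_contra! h
    have : Subsingleton H := ⟨fun a b => (h a).trans (h b).symm⟩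
    exact hH inferInstance
  obtain ⟨v, hv⟩ := hn
  obtain ⟨w, hw, hw0⟩ : ∃ w ∈ (ℂ ∙ v)ᗮ, w ≠ 0 := by
    by_contra! h
    have h1 : (ℂ ∙ v)ᗮ = ⊥ := (Submodule.eq_bot_iff _).mpr h
    rw [Submodule.orthogonal_eq_bot_iff] at h1
    exact hH (Module.finite_def.mpr (h1 ▸ Submodule.fg_span_singleton v))
  refine ⟨_, _, unit v hv, unit w hw0, ?_⟩
  rw [inner_smul_left, inner_smul_right, Submodule.mem_orthogonal_singleton_iff_inner_right.mp hw]
  simp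

namespace IsOperatorMean

variable [Nontrivial H]

/-- For `A` equal to `s` on `e₁` and `u` on its complement, the unit vector `√l e₁ + √k e₂` has
expectation `l s + k u` in `A` and `l f(s) + k f(u)` in `f(A)`. The Jensen inequality concludes. -/
theorem repFun_concave (hm : IsOperatorMean m) {e₁ e₂ : H} (h₁ : ‖e₁‖ = 1) (h₂ : ‖e₂‖ = 1)
    (h₁₂ : inner ℂ e₁ e₂ = 0) {l k : ℝ≥0} (hlk : l + k = 1) (s u : ℝ≥0) :
    l * repFun m s + k * repFun m u ≤ repFun m (l * s + k * u) := by
  have hP := PosOp.isStarProjection_proj (ℂ ∙ e₁)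
  have hl : (√(l : ℝ) : ℂ) * √(l : ℝ) = (l : ℝ) := by
    exact_mod_cast Real.mul_self_sqrt l.coe_nonneg
  have hk : (√(k : ℝ) : ℂ) * √(k : ℝ) = (k : ℝ) := by
    exact_mod_cast Real.mul_self_sqrt k.coe_nonneg
  have hval : ∀ s u : ℝ≥0, inner ℂ ((√(l : ℝ) : ℂ) • e₁ + (√(k : ℝ) : ℂ) • e₂)
      ((PosOp.twoValued _ hP s u).1 ((√(l : ℝ) : ℂ) • e₁ + (√(k : ℝ) : ℂ) • e₂)) =
      ((l * s + k * u : ℝ≥0) : ℝ) := fun s u => by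
    rw [PosOp.twoValued_apply h₁ h₁₂, inner_pair h₁ h₂ h₁₂]
    push_cast [Complex.conj_ofReal]
    linear_combination (s : ℂ) * hl + (u : ℂ) * hk
  have h := hm.re_inner_one_left_le (PosOp.twoValued _ hP s u)
    (norm_pair h₁ h₂ h₁₂ hlk) (hval s u)
  rw [hm.one_left_twoValued, ← inner_conj_symm, hval, Complex.conj_ofReal,
    Complex.ofReal_re] at h
  exact_mod_cast h

/-- This is concavity of `x ↦ 1 / f(1/x)`. With the same `A` and unit vector `ξ`, and `Q` the
projection onto its line, `r = 1/⟨A⁻¹ξ, ξ⟩`, so `r Q ≤ A`. Hence `f(r) Q ≤ f(A)`, which is tested on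
`f(A)⁻¹ ξ`. -/
theorem repFun_harmonic (hm : IsOperatorMean m) {e₁ e₂ : H} (h₁ : ‖e₁‖ = 1) (h₂ : ‖e₂‖ = 1)
    (h₁₂ : inner ℂ e₁ e₂ = 0) {l k : ℝ≥0} (hlk : l + k = 1) {s u r : ℝ≥0} (hs : 0 < s) (hu : 0 < u)
    (hr : r * (l / s + k / u) = 1) :
    repFun m r * (l / repFun m s + k / repFun m u) ≤ 1 := by
  have hP := PosOp.isStarProjection_proj (ℂ ∙ e₁)
  set ξ : H := (√(l : ℝ) : ℂ) • e₁ + (√(k : ℝ) : ℂ) • e₂ with hξ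
  have hξ1 : ‖ξ‖ = 1 := norm_pair h₁ h₂ h₁₂ hlk
  have hl := Real.mul_self_sqrt l.coe_nonneg
  have hk := Real.mul_self_sqrt k.coe_nonneg
  have hQ := PosOp.isStarProjection_proj (ℂ ∙ ξ)
  have hle : (r : ℝ) • (PosOp.proj (ℂ ∙ ξ)).1 ≤ (PosOp.twoValued _ hP s u).1 := by
    rw [PosOp.le_iff_re_inner ((IsSelfAdjoint.all (r : ℝ)).smul (PosOp.isSelfAdjoint _))
      (PosOp.isSelfAdjoint _)]
    intro x
    have hQx := PosOp.re_inner_proj hξ1 x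
    have hPx := PosOp.re_inner_proj h₁ x
    have hB := norm_sq_inner_pair_le h₁ h₂ h₁₂ x
    have hxx : (inner ℂ x x).re = ‖x‖ ^ 2 := inner_self_eq_norm_sq (𝕜 := ℂ) x
    have hξx : ‖inner ℂ ξ x‖ ≤ √l * ‖inner ℂ e₁ x‖ + √k * ‖inner ℂ e₂ x‖ := by
      rw [hξ, inner_add_left, inner_smul_left, inner_smul_left, Complex.conj_ofReal,
        Complex.conj_ofReal]
      refine (norm_add_le _ _).trans (le_of_eq ?_)
      rw [norm_mul, norm_mul, Complex.norm_real, Complex.norm_real,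
        Real.norm_of_nonneg (Real.sqrt_nonneg _), Real.norm_of_nonneg (Real.sqrt_nonneg _)]
    simp only [PosOp.twoValued, add_apply, smul_apply, sub_apply, one_apply_eq_self, inner_add_left,
      ← Complex.coe_smul, inner_smul_left, inner_sub_left, Complex.conj_ofReal, Complex.add_re,
      Complex.re_ofReal_mul, Complex.sub_re, hQx, hPx, hxx]
    set p := ‖inner ℂ e₁ x‖
    set q := ‖inner ℂ e₂ x‖
    have hs' : (0 : ℝ) < s := by exact_mod_cast hs
    have hu' : (0 : ℝ) < u := by exact_mod_cast hu
    have hr' : (r : ℝ) * (l / s + k / u) = 1 := by exact_mod_cast hr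
    -- Weighted Cauchy–Schwarz: the difference of the two sides is a square divided by `s u`.
    have hcs : (√l * p + √k * q) ^ 2 ≤ ((l : ℝ) / s + k / u) * (s * p ^ 2 + u * q ^ 2) := by
      have : ((l : ℝ) / s + k / u) * (s * p ^ 2 + u * q ^ 2) - (√l * p + √k * q) ^ 2 =
          (s * √k * p - u * √l * q) ^ 2 / (s * u) := by
        have key : ∀ a b : ℝ, (a * a / s + b * b / u) * (s * p ^ 2 + u * q ^ 2) -
            (a * p + b * q) ^ 2 = (s * b * p - u * a * q) ^ 2 / (s * u) := fun a b => by
          field_simp; ring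
        have := key √l √k
        rwa [hl, hk] at this
      have h2 : 0 ≤ (s * √k * p - u * √l * q) ^ 2 / (s * u) := by positivity
      linarith
    have h3 : ‖inner ℂ ξ x‖ ^ 2 ≤ (√l * p + √k * q) ^ 2 := by gcongr
    calc (r : ℝ) * ‖inner ℂ ξ x‖ ^ 2
        ≤ r * (((l : ℝ) / s + k / u) * (s * p ^ 2 + u * q ^ 2)) := by
          gcongr; exact h3.trans hcs
      _ = s * p ^ 2 + u * q ^ 2 := by rw [← mul_assoc, hr', one_mul]
      _ ≤ s * p ^ 2 + u * (‖x‖ ^ 2 - p ^ 2) := by gcongr; linarith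
  have h := hm.smul_proj_le_one_left hQ hle
  rw [hm.one_left_twoValued, PosOp.le_iff_re_inner
    ((IsSelfAdjoint.all (repFun m r : ℝ)).smul (PosOp.isSelfAdjoint _)) (PosOp.isSelfAdjoint _)] at h
  have hfs : (0 : ℝ) < repFun m s := by exact_mod_cast hm.repFun_pos hs
  have hfu : (0 : ℝ) < repFun m u := by exact_mod_cast hm.repFun_pos hu
  set w : ℝ := l / repFun m s + k / repFun m u with hw
  have hwval : (((√l : ℝ) : ℂ) * ((√l / repFun m s : ℝ) : ℂ) +
      ((√k : ℝ) : ℂ) * ((√k / repFun m u : ℝ) : ℂ)) = (w : ℝ) := by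
    rw [hw]
    rw [← Complex.ofReal_mul, ← Complex.ofReal_mul, ← Complex.ofReal_add, ← mul_div_assoc, hl,
      ← mul_div_assoc, hk]
  -- The vector is `f(A)⁻¹ ξ`; the inequality becomes `f(r) w² ≤ w`.
  have h1 := h (((√l / repFun m s : ℝ) : ℂ) • e₁ + ((√k / repFun m u : ℝ) : ℂ) • e₂)
  rw [PosOp.twoValued_apply h₁ h₁₂, smul_apply, ← Complex.coe_smul, inner_smul_left,
    Complex.conj_ofReal, Complex.re_ofReal_mul, PosOp.re_inner_proj hξ1, hξ,
    inner_pair h₁ h₂ h₁₂, inner_pair h₁ h₂ h₁₂, Complex.conj_ofReal, Complex.conj_ofReal, hwval] at h1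
  have hc1 : ((repFun m s : ℝ) : ℂ) * ((√l / repFun m s : ℝ) : ℂ) = ((√l : ℝ) : ℂ) := by
    norm_cast; field_simp
  have hc2 : ((repFun m u : ℝ) : ℂ) * ((√k / repFun m u : ℝ) : ℂ) = ((√k : ℝ) : ℂ) := by
    norm_cast; field_simp
  rw [hc1, hc2, Complex.conj_ofReal, Complex.conj_ofReal, hwval, Complex.norm_real,
    Complex.ofReal_re, Real.norm_eq_abs, sq_abs] at h1
  have hw0 : 0 < w := by
    have hlk' : (l : ℝ) + k = 1 := by exact_mod_cast hlk
    rcases eq_or_lt_of_le l.coe_nonneg with h0 | h0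
    · have : (0 : ℝ) < k := by linarith
      positivity
    · positivity
  have h2 : (repFun m r : ℝ) * w ≤ 1 := by
    have : (repFun m r : ℝ) * w * w ≤ 1 * w := by linarith [sq w, mul_assoc (repFun m r : ℝ) w w]
    exact le_of_mul_le_mul_right this hw0
  rw [hw] at h2
  exact_mod_cast h2

/-- A monotone concave function that is flat on `[a, b]` remains flat to the right. Concavity of `x
↦ 1 / f(1/x)` gives flatness to the left. -/
theorem eq_of_repFun_eq (hm : IsOperatorMean m) (hH : ¬ FiniteDimensional ℂ H) {a b : ℝ≥0}
    (ha : 0 < a) (hab : a < b) (h : repFun m a = repFun m b) {t : ℝ≥0} (ht : 0 < t) :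
    repFun m t = repFun m a := by
  obtain ⟨e₁, e₂, h₁, h₂, h₁₂⟩ := exists_orthonormal_pair hH
  rcases le_total a t with hat | hta
  · rcases le_total t b with htb | hbt
    · exact le_antisymm (h ▸ hm.repFun_mono htb) (hm.repFun_mono hat)
    refine le_antisymm ?_ (hm.repFun_mono hat)
    have hat' : a < t := hab.trans_le hbt
    have hne : (t : ℝ) - a ≠ 0 := (sub_pos.mpr (by exact_mod_cast hat')).ne'
    have hd : t - a ≠ 0 := (tsub_pos_of_lt hat').ne'
    -- These weights express `b` as a convex combination of `a` and `t`.
    have hsum : (t - b) / (t - a) + (b - a) / (t - a) = 1 := by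
      rw [← add_div, tsub_add_tsub_cancel hbt hab.le, div_self hd]
    have hcomb : (t - b) / (t - a) * a + (b - a) / (t - a) * t = b := by
      rw [← NNReal.coe_inj]
      push_cast [NNReal.coe_sub hbt, NNReal.coe_sub hab.le, NNReal.coe_sub hat]
      field_simp
      ring
    have hc := hm.repFun_concave h₁ h₂ h₁₂ hsum a t
    rw [hcomb, ← h] at hc
    have hk : 0 < (b - a) / (t - a) :=
      div_pos (tsub_pos_of_lt hab) (tsub_pos_of_lt hat')
    nth_rewrite 2 [← one_mul (repFun m a)] at hc
    rw [← hsum, add_mul, add_le_add_iff_left] at hc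
    exact le_of_mul_le_mul_left hc hk
  · refine le_antisymm (hm.repFun_mono hta) ?_
    rcases eq_or_lt_of_le hta with rfl | hta
    · rfl
    have htb := hta.trans hab
    have hat' : (0 : ℝ) < a := by exact_mod_cast ha
    have ht' : (0 : ℝ) < t := by exact_mod_cast ht
    have hb' : (0 : ℝ) < b := by exact_mod_cast ha.trans hab
    have hbt' : (0 : ℝ) < b - t := sub_pos.mpr (by exact_mod_cast htb)
    have hd : (b - t) * a ≠ 0 := mul_ne_zero (tsub_pos_of_lt htb).ne' ha.ne'
    -- These weights make `a` the weighted harmonic mean of `t` and `b`.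
    have hsum : t * (b - a) / ((b - t) * a) + b * (a - t) / ((b - t) * a) = 1 := by
      rw [← NNReal.coe_inj]
      push_cast [NNReal.coe_sub htb.le, NNReal.coe_sub hab.le, NNReal.coe_sub hta.le]
      field_simp
      ring
    have hcomb : a * (t * (b - a) / ((b - t) * a) / t + b * (a - t) / ((b - t) * a) / b) = 1 := by
      rw [← NNReal.coe_inj]
      push_cast [NNReal.coe_sub htb.le, NNReal.coe_sub hab.le, NNReal.coe_sub hta.le]
      field_simp
      ring
    have hc := hm.repFun_harmonic h₁ h₂ h₁₂ hsum ht (ha.trans hab) hcomb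
    rw [← h] at hc
    have hl : 0 < t * (b - a) / ((b - t) * a) :=
      div_pos (mul_pos ht (tsub_pos_of_lt hab)) (pos_iff_ne_zero.mpr hd)
    have hfa := hm.repFun_pos ha
    have hft := hm.repFun_pos ht
    rw [mul_add, mul_div_cancel₀ _ hfa.ne', ← hsum, add_le_add_iff_right, ← mul_div_assoc,
      div_le_iff₀ hft, mul_comm] at hc
    exact le_of_mul_le_mul_left hc hl

theorem eq_leftMean_of_repFun_eq_one (hm : IsOperatorMean m)
    (h : ∀ t : ℝ≥0, 0 < t → repFun m t = 1) : m = leftMean H := by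
  have h1 : repFun m = fun _ => 1 :=
    Continuous.ext_on (dense_compl_singleton (0 : ℝ≥0)) hm.continuous_repFun continuous_const
      fun t ht => h t (pos_iff_ne_zero.mpr ht)
  have hInv : ∀ A B : PosOp H, A.Inv → m A B = A := fun A B hA => by
    have h2 : m (PosOp.scalar H 1) ((A.rpow (-(1 / 2))).conj B) = PosOp.scalar H 1 := by
      apply Subtype.ext
      rw [hm.one_left, h1, cfc_const _ _ (Subtype.prop _)]
      rfl
    rw [hm.eq_conj_one_left hA, h2, hA.conj_rpow_one]
  funext A B
  have hdec := A.decreases_add_scalar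
  have hconst : PosOp.Decreases (fun _ : ℕ => B) B :=
    ⟨fun _ _ _ => le_rfl, fun _ => tendsto_const_nhds⟩
  have hd := (hm.downward _ _ _ _ hdec hconst).2
  have hA : ∀ n : ℕ, m (A + PosOp.scalar H (1 / ((n : ℝ≥0) + 1))) B =
      A + PosOp.scalar H (1 / ((n : ℝ≥0) + 1)) := fun n =>
    hInv _ B (A.inv_add_scalar (by positivity))
  simp only [hA] at hd
  exact Subtype.ext (ContinuousLinearMap.ext fun x => tendsto_nhds_unique (hd x) (hdec.2 x))

theorem strictMono_repFun (hm : IsOperatorMean m) (hH : ¬ FiniteDimensional ℂ H)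
    (hne : m ≠ leftMean H) : StrictMono (repFun m) := by
  intro a b hab
  refine (hm.repFun_mono hab.le).lt_of_ne fun h => hne ?_
  -- Since `a` may be `0`, the flat interval is shrunk to one with positive endpoints.
  obtain ⟨c, hac, hcb⟩ := exists_between hab
  have hc : 0 < c := (zero_le).trans_lt hac
  have hcb' : repFun m c = repFun m b :=
    le_antisymm (hm.repFun_mono hcb.le) (h ▸ hm.repFun_mono hac.le)
  refine hm.eq_leftMean_of_repFun_eq_one fun t ht => ?_
  rw [hm.eq_of_repFun_eq hH hc hcb hcb' ht, ← hm.eq_of_repFun_eq hH hc hcb hcb' one_pos,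
    hm.repFun_one]

end IsOperatorMean

end StrictMonotonicity

/-! ### Monotone strong limits of positive operators. -/

section StrongLimits

variable {H : Type*} [NormedAddCommGroup H] [InnerProductSpace ℂ H] [CompleteSpace H]

/-- With `R = √T`, `‖Tξ‖² ≤ ‖R‖² ‖Rξ‖² = ‖T‖ ⟨Tξ, ξ⟩`. This upgrades convergence of quadratic forms
to strong convergence. -/
theorem norm_apply_sq_le {T S : H →L[ℂ] H} (hT : 0 ≤ T) (hTS : T ≤ S) (ξ : H) :
    ‖T ξ‖ ^ 2 ≤ ‖S‖ * (inner ℂ (T ξ) ξ).re := by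
  have h1 := CFC.sqrt_mul_sqrt_self T hT
  set R := CFC.sqrt T
  have hR : IsSelfAdjoint R := IsSelfAdjoint.of_nonneg (CFC.sqrt_nonneg T)
  have h2 : ‖R‖ * ‖R‖ = ‖T‖ := by
    rw [← h1]
    nth_rewrite 3 [← hR.star_eq]
    exact (CStarRing.norm_star_mul_self).symm
  have h3 : T ξ = R (R ξ) := by rw [← h1]; rfl
  have h4 : (inner ℂ (T ξ) ξ).re = ‖R ξ‖ ^ 2 := by
    rw [h3, ← inner_self_eq_norm_sq (𝕜 := ℂ)]
    have : inner ℂ (R (R ξ)) ξ = inner ℂ (R ξ) (R ξ) := by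
      rw [← ContinuousLinearMap.adjoint_inner_right]
      have h5 : ContinuousLinearMap.adjoint R = R := hR.star_eq
      rw [h5]
    rw [this]; rfl
  rw [h4]
  calc ‖T ξ‖ ^ 2 ≤ (‖R‖ * ‖R ξ‖) ^ 2 := by rw [h3]; gcongr; exact R.le_opNorm _
    _ = ‖T‖ * ‖R ξ‖ ^ 2 := by rw [← h2]; ring
    _ ≤ _ := by gcongr; exact CStarAlgebra.norm_le_norm_of_nonneg_of_le hT hTS

namespace PosOp

theorem TendstoSOT.unique {ι : Type*} {l : Filter ι} [l.NeBot] {A : ι → PosOp H} {L L' : PosOp H}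
    (h : TendstoSOT A l L) (h' : TendstoSOT A l L') : L = L' :=
  Subtype.ext (ContinuousLinearMap.ext fun ξ => tendsto_nhds_unique (h ξ) (h' ξ))

theorem TendstoSOT.le {ι : Type*} {l : Filter ι} [l.NeBot] {A B : ι → PosOp H} {L M : PosOp H}
    (hA : TendstoSOT A l L) (hB : TendstoSOT B l M) (h : ∀ᶠ i in l, A i ≤ B i) : L ≤ M := by
  change L.1 ≤ M.1
  rw [le_iff_re_inner L.isSelfAdjoint M.isSelfAdjoint]
  intro x
  have hc : Continuous fun y : H => (inner ℂ y x).re := by fun_prop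
  refine le_of_tendsto_of_tendsto ((hc.tendsto _).comp (hA x)) ((hc.tendsto _).comp (hB x)) ?_
  filter_upwards [h] with i hi
  exact (le_iff_re_inner (A i).isSelfAdjoint (B i).isSelfAdjoint).mp hi x

theorem tendstoSOT_const {ι : Type*} (l : Filter ι) (A : PosOp H) :
    TendstoSOT (fun _ : ι => A) l A := fun _ => tendsto_const_nhds

theorem decreases_const (A : PosOp H) : Decreases (fun _ : ℕ => A) A :=
  ⟨fun _ _ _ => le_rfl, tendstoSOT_const _ A⟩

theorem Decreases.le {A : ℕ → PosOp H} {L : PosOp H} (h : Decreases A L) (n : ℕ) : L ≤ A n :=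
  h.2.le (tendstoSOT_const _ (A n)) (eventually_atTop.mpr ⟨n, fun _ hk => h.1 hk⟩)

theorem Decreases.le_of_forall_le {A : ℕ → PosOp H} {L M : PosOp H} (h : Decreases A L)
    (hM : ∀ n, M ≤ A n) : M ≤ L :=
  (tendstoSOT_const _ M).le h.2 (Eventually.of_forall hM)

theorem Decreases.shift {A : ℕ → PosOp H} {L : PosOp H} (h : Decreases A L) :
    Decreases (fun n => A (n + 1)) L :=
  ⟨fun _ _ hij => h.1 (by lia), fun ξ => (h.2 ξ).comp (tendsto_add_atTop_nat 1)⟩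

theorem Decreases.add_scalar {A : ℕ → PosOp H} {L : PosOp H} (h : Decreases A L) (ε : ℝ≥0) :
    Decreases (fun n => A n + scalar H ε) (L + scalar H ε) :=
  ⟨fun _ _ hij => add_scalar_mono (h.1 hij) le_rfl, fun ξ => (h.2 ξ).add_const ((scalar H ε).1 ξ)⟩

/-- A decreasing sequence of positive operators converges strongly. -/
theorem exists_decreases {A : ℕ → PosOp H} (hA : Antitone A) : ∃ L, Decreases A L := by
  have hlim : ∀ ξ, ∃ y, Tendsto (fun n => (A n).1 ξ) atTop (𝓝 y) := fun ξ => by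
    set a : ℕ → ℝ := fun n => (inner ℂ ((A n).1 ξ) ξ).re with ha
    have hanti : Antitone a := fun i j hij =>
      (le_iff_re_inner (A j).isSelfAdjoint (A i).isSelfAdjoint).mp (hA hij) ξ
    have hbdd : BddBelow (Set.range a) := ⟨0, by
      rintro _ ⟨n, rfl⟩
      exact ((ContinuousLinearMap.nonneg_iff_isPositive _).mp (A n).2).re_inner_nonneg_left ξ⟩
    have hconv := tendsto_atTop_ciInf hanti hbdd
    set a' := ⨅ n, a n
    -- For `n ≤ k`, `norm_apply_sq_le` applied to `A n - A k ≤ A 0` bounds the distance by this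
    -- square root.
    refine cauchySeq_tendsto_of_complete (cauchySeq_of_le_tendsto_0'
      (fun n => √(‖(A 0).1‖ * (a n - a'))) (fun n k hnk => ?_) ?_)
    · rw [dist_eq_norm]
      apply Real.le_sqrt_of_sq_le
      have h1 : 0 ≤ (A n).1 - (A k).1 := sub_nonneg.mpr (hA hnk)
      have h2 : (A n).1 - (A k).1 ≤ (A 0).1 :=
        (sub_le_self _ (A k).2).trans (hA (Nat.zero_le n))
      have h3 := norm_apply_sq_le h1 h2 ξ
      rw [sub_apply, inner_sub_left, Complex.sub_re] at h3
      refine h3.trans (mul_le_mul_of_nonneg_left ?_ (norm_nonneg _))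
      exact sub_le_sub_left (ciInf_le hbdd k) _
    · have h1 : Tendsto (fun n => √(‖(A 0).1‖ * (a n - a'))) atTop
          (𝓝 √(‖(A 0).1‖ * (a' - a'))) :=
        ((hconv.sub_const a').const_mul _).sqrt
      simpa using h1
  choose y hy using hlim
  let T : H →L[ℂ] H := continuousLinearMapOfTendsto (fun n => (A n).1) (f := y)
    (tendsto_pi_nhds.mpr hy)
  have hT : ∀ ξ, Tendsto (fun n => (A n).1 ξ) atTop (𝓝 (T ξ)) := hy
  have hpos : 0 ≤ T := by
    rw [ContinuousLinearMap.nonneg_iff_isPositive, ContinuousLinearMap.isPositive_iff_complex]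
    intro x
    have hpos : ∀ n, 0 ≤ (inner ℂ ((A n).1 x) x).re ∧
        ((inner ℂ ((A n).1 x) x).re : ℂ) = inner ℂ ((A n).1 x) x := fun n => by
      have := (ContinuousLinearMap.isPositive_iff_complex _).mp
        ((ContinuousLinearMap.nonneg_iff_isPositive _).mp (A n).2) x
      exact ⟨this.2, this.1⟩
    have hc : Tendsto (fun n => inner ℂ ((A n).1 x) x) atTop (𝓝 (inner ℂ (T x) x)) :=
      (hT x).inner tendsto_const_nhds
    have hre := (Complex.continuous_re.tendsto _).comp hc
    refine ⟨?_, ge_of_tendsto' hre fun n => (hpos n).1⟩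
    refine tendsto_nhds_unique ((Complex.continuous_ofReal.tendsto _).comp hre) ?_
    exact hc.congr fun n => (hpos n).2.symm
  exact ⟨⟨T, hpos⟩, hA, hT⟩

/-- This transfers convergence from a decreasing sequence to an arbitrary filter, in particular to
`ε ↘ 0`. -/
theorem tendstoSOT_of_squeeze {ι : Type*} {l : Filter ι} {X : ι → PosOp H} {Y : ℕ → PosOp H}
    {L : PosOp H} (hY : Decreases Y L) (hL : ∀ᶠ i in l, L ≤ X i)
    (hX : ∀ n, ∀ᶠ i in l, X i ≤ Y n) : TendstoSOT X l L := by
  intro ξ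
  rw [tendsto_iff_norm_sub_tendsto_zero]
  have hb : Tendsto (fun n => √(‖(Y 0).1 - L.1‖ * (inner ℂ ((Y n).1 ξ - L.1 ξ) ξ).re)) atTop
      (𝓝 0) := by
    have hc : Continuous fun y : H => √(‖(Y 0).1 - L.1‖ * (inner ℂ (y - L.1 ξ) ξ).re) := by fun_prop
    have h := (hc.tendsto _).comp (hY.2 ξ)
    rw [sub_self, inner_zero_left, Complex.zero_re, mul_zero, Real.sqrt_zero] at h
    exact h
  rw [tendsto_order]
  refine ⟨fun a ha => Eventually.of_forall fun i => ha.trans_le (norm_nonneg _), fun a ha => ?_⟩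
  obtain ⟨n, hn⟩ := (hb.eventually (gt_mem_nhds ha)).exists
  filter_upwards [hL, hX n] with i h1 h2
  refine lt_of_le_of_lt (Real.le_sqrt_of_sq_le ?_) hn
  have h3 : (X i).1 ≤ (Y n).1 := h2
  have h4 : (Y n).1 ≤ (Y 0).1 := hY.1 (Nat.zero_le n)
  have h5 := norm_apply_sq_le (T := (X i).1 - L.1) (S := (Y 0).1 - L.1)
    (sub_nonneg.mpr h1) (sub_le_sub_right (h3.trans h4) _) ξ
  rw [sub_apply] at h5
  refine h5.trans (mul_le_mul_of_nonneg_left ?_ (norm_nonneg _))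
  rw [inner_sub_left, inner_sub_left, Complex.sub_re, Complex.sub_re]
  exact sub_le_sub_right
    ((le_iff_re_inner (X i).isSelfAdjoint (Y n).isSelfAdjoint).mp h3 ξ) _

end PosOp

end StrongLimits

/-! ### Existence and uniqueness of the fixed point. -/

section FixedPoint

variable {H : Type*} [NormedAddCommGroup H] [InnerProductSpace ℂ H] [CompleteSpace H]

namespace PosOp

/-- The positive multiple `t A`. -/
noncomputable def scale (t : ℝ≥0) (A : PosOp H) : PosOp H :=
  ⟨(t : ℝ) • A.1, smul_nonneg t.2 A.2⟩

theorem conj_scalar_sqrt (t : ℝ≥0) (A : PosOp H) :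
    (scalar H (NNReal.sqrt t)).conj A = scale t A := by
  apply Subtype.ext
  rw [coe_conj, coe_scalar, smul_mul_assoc, one_mul, mul_smul_comm, mul_one, smul_smul]
  change _ = (t : ℝ) • A.1
  rw [← NNReal.coe_mul, NNReal.mul_self_sqrt]

theorem scale_mono (t : ℝ≥0) {A B : PosOp H} (h : A ≤ B) : scale t A ≤ scale t B :=
  show (t : ℝ) • A.1 ≤ (t : ℝ) • B.1 from smul_le_smul_of_nonneg_left h t.2

theorem scale_mono_left {s t : ℝ≥0} (h : s ≤ t) (A : PosOp H) : scale s A ≤ scale t A :=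
  show (s : ℝ) • A.1 ≤ (t : ℝ) • A.1 from smul_le_smul_of_nonneg_right h A.2

theorem scale_scale (s t : ℝ≥0) (A : PosOp H) : scale s (scale t A) = scale (s * t) A :=
  Subtype.ext (by simp [scale, smul_smul])

theorem one_scale (A : PosOp H) : scale 1 A = A := Subtype.ext (by simp [scale])

theorem scale_scalar (s t : ℝ≥0) : scale s (scalar H t) = scalar H (s * t) :=
  Subtype.ext (by simp [scale, coe_scalar, smul_smul])

theorem conj_scale (C : PosOp H) (t : ℝ≥0) (A : PosOp H) :
    C.conj (scale t A) = scale t (C.conj A) :=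
  Subtype.ext (by simp [scale, coe_conj])

theorem Inv.of_le {A B : PosOp H} (hA : A.Inv) (h : A ≤ B) : B.Inv :=
  (IsStrictlyPositive.of_le hA.isStrictlyPositive h).isUnit

theorem Inv.conj {A C : PosOp H} (hA : A.Inv) (hC : C.Inv) : (C.conj A).Inv :=
  (IsUnit.mul hC hA).mul hC

theorem le_scalar_nnnorm (A : PosOp H) : A ≤ scalar H ‖A.1‖₊ :=
  A.isSelfAdjoint.le_algebraMap_norm_self

theorem Inv.exists_scalar_le [Nontrivial H] {A : PosOp H} (hA : A.Inv) : ∃ d : ℝ≥0, 0 < d ∧ scalar H d ≤ A := by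
  obtain ⟨r, hr, hrA⟩ := (CFC.exists_pos_algebraMap_le_iff A.isSelfAdjoint).mpr fun x hx =>
    (spectrum_nonneg_of_nonneg A.2 hx).lt_of_ne' fun h =>
      spectrum.zero_notMem ℝ hA (h ▸ hx)
  exact ⟨⟨r, hr.le⟩, hr, hrA⟩

end PosOp

namespace IsOperatorMean

variable {m τ σ : PosOp H → PosOp H → PosOp H}

theorem scale (hm : IsOperatorMean m) {t : ℝ≥0} (ht : t ≠ 0) (A B : PosOp H) :
    m (PosOp.scale t A) (PosOp.scale t B) = PosOp.scale t (m A B) := by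
  have h := hm.conj_scalar (t := NNReal.sqrt t) (by simpa using ht) A B
  simp only [PosOp.conj_scalar_sqrt] at h
  exact h.symm

theorem scalar_self (hm : IsOperatorMean m) {t : ℝ≥0} (ht : t ≠ 0) :
    m (PosOp.scalar H t) (PosOp.scalar H t) = PosOp.scalar H t := by
  have h := hm.scale ht (PosOp.scalar H 1) (PosOp.scalar H 1)
  rwa [hm.normalized, PosOp.scale_scalar, mul_one] at h

/-- Congruence by `Y^{-1/2}` reduces the claim to `f(α⁻¹ x) ≤ β f(x)` on the spectrum of `D =
Y^{-1/2} A Y^{-1/2}`. That spectrum is compact and avoids `0`, so the ratio, which is below `1`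
pointwise, has a maximum below `1`. -/
theorem exists_scale_lt (hm : IsOperatorMean m) (hH : ¬ FiniteDimensional ℂ H) [Nontrivial H]
    (hne : m ≠ leftMean H) {Y A : PosOp H} (hY : Y.Inv) (hA : A.Inv) {α : ℝ≥0} (hα : 1 < α) :
    ∃ β < 1, m Y (PosOp.scale α⁻¹ A) ≤ PosOp.scale β (m Y A) := by
  have hf := hm.strictMono_repFun hH hne
  have hc := hm.continuous_repFun
  have hYi : (Y.rpow (-(1 / 2))).Inv :=
    ⟨⟨_, _, hY.rpow_mul_rpow (x := -(1 / 2)) (y := 1 / 2) (by ring),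
      hY.rpow_mul_rpow (x := 1 / 2) (y := -(1 / 2)) (by ring)⟩, rfl⟩
  set D := (Y.rpow (-(1 / 2))).conj A with hD
  have hDi : D.Inv := hA.conj hYi
  have h0 : (0 : ℝ≥0) ∉ spectrum ℝ≥0 D.1 := spectrum.zero_notMem _ hDi
  have hpos : ∀ x ∈ spectrum ℝ≥0 D.1, 0 < x := fun x hx =>
    pos_iff_ne_zero.mpr fun h => h0 (h ▸ hx)
  obtain ⟨β, hβ, hle⟩ : ∃ β < 1, ∀ x ∈ spectrum ℝ≥0 D.1,
      repFun m (α⁻¹ * x) ≤ β * repFun m x := by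
    rcases (spectrum ℝ≥0 D.1).eq_empty_or_nonempty with he | hne'
    · exact ⟨0, one_pos, by simp [he]⟩
    have hcont : ContinuousOn (fun x => repFun m (α⁻¹ * x) / repFun m x) (spectrum ℝ≥0 D.1) :=
      (hc.comp (continuous_const_mul _)).continuousOn.div hc.continuousOn fun x hx =>
        (hm.repFun_pos (hpos x hx)).ne'
    obtain ⟨x, hx, hmax⟩ := (spectrum.isCompact_nnreal D.1).exists_isMaxOn hne' hcont
    refine ⟨repFun m (α⁻¹ * x) / repFun m x, ?_, fun y hy => ?_⟩
    · rw [div_lt_one (hm.repFun_pos (hpos x hx))]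
      refine hf ?_
      exact mul_lt_of_lt_one_left (hpos x hx) (inv_lt_one_of_one_lt₀ hα)
    · rw [← div_le_iff₀ (hm.repFun_pos (hpos y hy))]
      exact hmax hy
  refine ⟨β, hβ, ?_⟩
  rw [hm.eq_conj_one_left hY, hm.eq_conj_one_left hY A, ← PosOp.conj_scale, PosOp.conj_scale,
    ← hD]
  refine PosOp.conj_mono _ ?_
  change (m (PosOp.scalar H 1) (PosOp.scale α⁻¹ D)).1 ≤ (β : ℝ) • (m (PosOp.scalar H 1) D).1
  rw [hm.one_left, hm.one_left]
  have h1 : (PosOp.scale α⁻¹ D).1 = α⁻¹ • D.1 := rfl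
  have h2 : (β : ℝ) • cfc (repFun m) D.1 = β • cfc (repFun m) D.1 := rfl
  rw [h1, h2, ← cfc_comp_const_mul α⁻¹ (repFun m) D.1 (by fun_prop) D.2, ← cfc_const_mul ..]
  exact cfc_mono fun x hx => hle x hx

end IsOperatorMean

/-- The map `X ↦ (X σ A) τ (X σ B)`. -/
def deformMap (τ σ : PosOp H → PosOp H → PosOp H) (A B X : PosOp H) : PosOp H :=
  τ (σ X A) (σ X B)

section

variable {τ σ : PosOp H → PosOp H → PosOp H} (hτ : IsOperatorMean τ) (hσ : IsOperatorMean σ)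

include hτ hσ

theorem deformMap_mono {A A' B B' X X' : PosOp H} (hA : A ≤ A') (hB : B ≤ B') (hX : X ≤ X') :
    deformMap τ σ A B X ≤ deformMap τ σ A' B' X' :=
  hτ.mono _ _ _ _ (hσ.mono _ _ _ _ hX hA) (hσ.mono _ _ _ _ hX hB)

theorem deformMap_scalar {t : ℝ≥0} (ht : t ≠ 0) :
    deformMap τ σ (PosOp.scalar H t) (PosOp.scalar H t) (PosOp.scalar H t) = PosOp.scalar H t := by
  rw [deformMap, hσ.scalar_self ht, hτ.scalar_self ht]

theorem deformMap_decreases {A B X : ℕ → PosOp H} {A₀ B₀ X₀ : PosOp H}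
    (hA : PosOp.Decreases A A₀) (hB : PosOp.Decreases B B₀) (hX : PosOp.Decreases X X₀) :
    PosOp.Decreases (fun n => deformMap τ σ (A n) (B n) (X n)) (deformMap τ σ A₀ B₀ X₀) :=
  hτ.downward _ _ _ _ (hσ.downward _ _ _ _ hX hA) (hσ.downward _ _ _ _ hX hB)

theorem deformMap_conj {C D : PosOp H} (h1 : C.1 * D.1 = 1) (h2 : D.1 * C.1 = 1) (A B X : PosOp H) :
    C.conj (deformMap τ σ A B X) = deformMap τ σ (C.conj A) (C.conj B) (C.conj X) := by
  rw [deformMap, hτ.conj_eq h1 h2, hσ.conj_eq h1 h2, hσ.conj_eq h1 h2, deformMap]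

/-- Iterating downwards from a large multiple of the identity produces a solution which
dominates every subsolution. -/
theorem exists_isFixedSolution [Nontrivial H] {A B W : PosOp H} (hA : A.Inv) (hB : B.Inv)
    (hW : W ≤ deformMap τ σ A B W) : ∃ X, IsFixedSolution τ σ A B X ∧ W ≤ X := by
  obtain ⟨d₁, hd₁, hd₁A⟩ := hA.exists_scalar_le
  obtain ⟨d₂, hd₂, hd₂B⟩ := hB.exists_scalar_le
  -- A scalar above `A`, `B` and `W`: then `F (c I) ≤ c I`, and the iteration starts above `W`.
  set c : ℝ≥0 := ‖A.1‖₊ + ‖B.1‖₊ + ‖W.1‖₊ + 1 with hc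
  have hc0 : c ≠ 0 := by positivity
  have hAc : A ≤ PosOp.scalar H c := A.le_scalar_nnnorm.trans (PosOp.scalar_mono (by
    rw [hc, add_assoc, add_assoc]; exact le_self_add))
  have hBc : B ≤ PosOp.scalar H c := B.le_scalar_nnnorm.trans (PosOp.scalar_mono (by
    rw [hc, add_assoc, add_right_comm]; exact le_add_self))
  have hWc : W ≤ PosOp.scalar H c := W.le_scalar_nnnorm.trans (PosOp.scalar_mono (by
    rw [hc]; exact le_add_self.trans le_self_add))
  set F := deformMap τ σ A B with hF
  have hmono : Monotone F := fun X Y h => deformMap_mono hτ hσ le_rfl le_rfl h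
  have hFc : F (PosOp.scalar H c) ≤ PosOp.scalar H c :=
    (deformMap_mono hτ hσ hAc hBc le_rfl).trans (deformMap_scalar hτ hσ hc0).le
  have hlow : ∀ V : PosOp H, V ≤ F V → V ≤ PosOp.scalar H c →
      ∀ n, V ≤ F^[n] (PosOp.scalar H c) := by
    intro V hV hVc n
    induction n with
    | zero => exact hVc
    | succ n ih =>
      rw [Function.iterate_succ_apply']
      exact hV.trans (hmono ih)
  obtain ⟨X, hX⟩ := PosOp.exists_decreases (hmono.antitone_iterate_of_map_le hFc)
  refine ⟨X, ⟨?_, ?_⟩, hX.le_of_forall_le (hlow W hW hWc)⟩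
  -- A scalar `d I` below `A`, `B` and the starting point is a subsolution, so the limit stays above
  -- it and is invertible.
  · obtain ⟨d, hd, hd1, hd2, hd3⟩ : ∃ d : ℝ≥0, 0 < d ∧ d ≤ d₁ ∧ d ≤ d₂ ∧ d ≤ c :=
      ⟨min d₁ (min d₂ c), lt_min hd₁ (lt_min hd₂ (pos_iff_ne_zero.mpr hc0)), min_le_left _ _,
        (min_le_right _ _).trans (min_le_left _ _), (min_le_right _ _).trans (min_le_right _ _)⟩
    refine (PosOp.scalar_inv hd.ne').of_le
      (hX.le_of_forall_le (hlow (PosOp.scalar H d) ?_ (PosOp.scalar_mono hd3)))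
    exact (deformMap_scalar hτ hσ hd.ne').ge.trans (deformMap_mono hτ hσ
      ((PosOp.scalar_mono hd1).trans hd₁A) ((PosOp.scalar_mono hd2).trans hd₂B) le_rfl)
  · have h1 := (deformMap_decreases hτ hσ (PosOp.decreases_const A) (PosOp.decreases_const B) hX).2
    have h2 := hX.shift.2
    simp only [Function.iterate_succ_apply'] at h2
    exact h2.unique h1

/-- If the least `α` with `X ≤ α Y` exceeded `1`, applying the fixed point map to `X ≤ α Y` would
give a strictly smaller constant. -/
theorem IsFixedSolution.le [Nontrivial H] (hH : ¬ FiniteDimensional ℂ H) (hne : σ ≠ leftMean H)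
    {A B X Y : PosOp H} (hA : A.Inv) (hB : B.Inv) (hX : IsFixedSolution τ σ A B X)
    (hY : IsFixedSolution τ σ A B Y) : X ≤ Y := by
  set S : Set ℝ≥0 := {α | X ≤ PosOp.scale α Y} with hS
  have hclosed : IsClosed S := by
    have hc : Continuous fun α : ℝ≥0 => (α : ℝ) • Y.1 := by fun_prop
    exact isClosed_Ici.preimage hc
  have hnonempty : S.Nonempty := by
    obtain ⟨d, hd, hdY⟩ := hY.1.exists_scalar_le
    refine ⟨‖X.1‖₊ / d, X.le_scalar_nnnorm.trans ?_⟩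
    have := PosOp.scale_mono (‖X.1‖₊ / d) hdY
    rwa [PosOp.scale_scalar, div_mul_cancel₀ _ hd.ne'] at this
  have hmem := hclosed.csInf_mem hnonempty (OrderBot.bddBelow S)
  set α := sInf S with hα
  rcases le_or_gt α 1 with h1 | h1
  · exact (show X ≤ PosOp.scale α Y from hmem).trans
      ((PosOp.scale_mono_left h1 Y).trans (PosOp.one_scale Y).le)
  exfalso
  have hα0 : α ≠ 0 := (one_pos.trans h1).ne'
  obtain ⟨β₁, hβ₁, hle₁⟩ := hσ.exists_scale_lt hH hne hY.1 hA h1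
  obtain ⟨β₂, hβ₂, hle₂⟩ := hσ.exists_scale_lt hH hne hY.1 hB h1
  -- Including `1 / 2` in the maximum keeps `β` positive, as homogeneity of `τ` with factor `α β`
  -- requires.
  obtain ⟨β, hβ, hβ0, h1β, h2β⟩ : ∃ β : ℝ≥0, β < 1 ∧ 0 < β ∧ β₁ ≤ β ∧ β₂ ≤ β :=
    ⟨max (1 / 2) (max β₁ β₂), max_lt (by norm_num) (max_lt hβ₁ hβ₂),
      lt_max_of_lt_left (by norm_num), (le_max_left _ _).trans (le_max_right _ _),
      (le_max_right _ _).trans (le_max_right _ _)⟩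
  -- By homogeneity `(α Y) σ A = α (Y σ (α⁻¹ A))`.
  have key : ∀ A : PosOp H, σ Y (PosOp.scale α⁻¹ A) ≤ PosOp.scale β (σ Y A) →
      σ (PosOp.scale α Y) A ≤ PosOp.scale (α * β) (σ Y A) := fun A hA => by
    have h2 := hσ.scale hα0 Y (PosOp.scale α⁻¹ A)
    rw [PosOp.scale_scale, mul_inv_cancel₀ hα0, PosOp.one_scale] at h2
    rw [h2, ← PosOp.scale_scale]
    exact PosOp.scale_mono α hA
  have hXle : X ≤ PosOp.scale (α * β) Y := by
    calc X = deformMap τ σ A B X := hX.2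
      _ ≤ deformMap τ σ A B (PosOp.scale α Y) := deformMap_mono hτ hσ le_rfl le_rfl hmem
      _ ≤ τ (PosOp.scale (α * β) (σ Y A)) (PosOp.scale (α * β) (σ Y B)) :=
        hτ.mono _ _ _ _ (key A (hle₁.trans (PosOp.scale_mono_left h1β _)))
          (key B (hle₂.trans (PosOp.scale_mono_left h2β _)))
      _ = PosOp.scale (α * β) Y := by
        rw [hτ.scale (mul_ne_zero hα0 hβ0.ne'), ← hY.2]
  have h3 : α ≤ α * β := csInf_le (OrderBot.bddBelow S) hXle
  exact absurd h3 (not_le.mpr (mul_lt_of_lt_one_right (one_pos.trans h1) hβ))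

theorem existsUnique_isFixedSolution [Nontrivial H] (hH : ¬ FiniteDimensional ℂ H)
    (hne : σ ≠ leftMean H) {A B : PosOp H} (hA : A.Inv) (hB : B.Inv) :
    ∃! X, IsFixedSolution τ σ A B X := by
  obtain ⟨X, hX, -⟩ := exists_isFixedSolution hτ hσ hA hB
    (W := PosOp.scalar H 0) (by
      change (PosOp.scalar H 0).1 ≤ _
      rw [PosOp.coe_scalar, NNReal.coe_zero, zero_smul]
      exact Subtype.prop _)
  exact ⟨X, hX, fun Y hY => le_antisymm (hY.le hτ hσ hH hne hA hB hX)
    (hX.le hτ hσ hH hne hA hB hY)⟩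

end

end FixedPoint

/-! ### The deformed mean and its scalar equations. -/

section Deformation

variable {H : Type*} [NormedAddCommGroup H] [InnerProductSpace ℂ H] [CompleteSpace H]

theorem PosOp.le_add_scalar_of_norm_sub_le {A B : PosOp H} {ε : ℝ≥0} (h : ‖A.1 - B.1‖ ≤ ε) :
    A ≤ B + PosOp.scalar H ε := by
  have hs : IsSelfAdjoint (A.1 - B.1) := A.isSelfAdjoint.sub B.isSelfAdjoint
  have h1 : A.1 - B.1 ≤ algebraMap ℝ (H →L[ℂ] H) ε :=
    hs.le_algebraMap_norm_self.trans (algebraMap_mono (H →L[ℂ] H) h)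
  exact sub_le_iff_le_add'.mp h1

theorem PosOp.conj_add (C A B : PosOp H) : C.conj (A + B) = C.conj A + C.conj B :=
  Subtype.ext (by simp [PosOp.coe_conj, mul_add, add_mul])

theorem PosOp.Inv.exists_inverse {C : PosOp H} (hC : C.Inv) :
    ∃ D : PosOp H, C.1 * D.1 = 1 ∧ D.1 * C.1 = 1 := by
  have h1 : (C.rpow 1).1 = C.1 := CFC.rpow_one C.1 C.2
  refine ⟨C.rpow (-1), ?_, ?_⟩
  · rw [← h1]; exact hC.rpow_mul_rpow (by ring)
  · rw [← h1]; exact hC.rpow_mul_rpow (by ring)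

/-- The positive invertible solution of `X = (X σ A) τ (X σ B)`, for invertible `A` and `B`. -/
noncomputable def fixedSolution (τ σ : PosOp H → PosOp H → PosOp H) (A B : PosOp H) : PosOp H :=
  Classical.epsilon (IsFixedSolution τ σ A B)

variable [Nontrivial H] {τ σ : PosOp H → PosOp H → PosOp H}
  (hτ : IsOperatorMean τ) (hσ : IsOperatorMean σ) (hH : ¬ FiniteDimensional ℂ H)
  (hne : σ ≠ leftMean H)

include hτ hσ hH hne

theorem isFixedSolution_fixedSolution {A B : PosOp H} (hA : A.Inv) (hB : B.Inv) :
    IsFixedSolution τ σ A B (fixedSolution τ σ A B) :=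
  Classical.epsilon_spec (existsUnique_isFixedSolution hτ hσ hH hne hA hB).exists

theorem IsFixedSolution.eq_fixedSolution {A B X : PosOp H} (hA : A.Inv) (hB : B.Inv)
    (hX : IsFixedSolution τ σ A B X) : X = fixedSolution τ σ A B :=
  (existsUnique_isFixedSolution hτ hσ hH hne hA hB).unique hX
    (isFixedSolution_fixedSolution hτ hσ hH hne hA hB)

/-- The solution for the smaller data is a subsolution for the larger data, hence lies below a
solution there, which is the only one. -/
theorem fixedSolution_mono {A A' B B' : PosOp H} (hA : A.Inv) (hB : B.Inv) (hAA' : A ≤ A')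
    (hBB' : B ≤ B') : fixedSolution τ σ A B ≤ fixedSolution τ σ A' B' := by
  obtain ⟨X, hX, hle⟩ := exists_isFixedSolution hτ hσ (hA.of_le hAA') (hB.of_le hBB')
    (W := fixedSolution τ σ A B)
    ((isFixedSolution_fixedSolution hτ hσ hH hne hA hB).2.le.trans
      (deformMap_mono hτ hσ hAA' hBB' le_rfl))
  rwa [hX.eq_fixedSolution hτ hσ hH hne (hA.of_le hAA') (hB.of_le hBB')] at hle

theorem fixedSolution_conj {A B C : PosOp H} (hA : A.Inv) (hB : B.Inv) (hC : C.Inv) :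
    C.conj (fixedSolution τ σ A B) = fixedSolution τ σ (C.conj A) (C.conj B) := by
  obtain ⟨D, h1, h2⟩ := hC.exists_inverse
  have hX := isFixedSolution_fixedSolution hτ hσ hH hne hA hB
  refine IsFixedSolution.eq_fixedSolution hτ hσ hH hne (hA.conj hC) (hB.conj hC)
    ⟨hX.1.conj hC, ?_⟩
  have h3 := deformMap_conj hτ hσ h1 h2 A B (fixedSolution τ σ A B)
  have h4 : deformMap τ σ A B (fixedSolution τ σ A B) = fixedSolution τ σ A B := hX.2.symm
  rw [h4] at h3
  exact h3

/-- The limit solves the limiting equation by downward continuity, and is invertible because it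
dominates the solution for `A₀`, `B₀`. Uniqueness identifies the two. -/
theorem fixedSolution_decreases {A B : ℕ → PosOp H} {A₀ B₀ : PosOp H} (hA₀ : A₀.Inv)
    (hB₀ : B₀.Inv) (hA : PosOp.Decreases A A₀) (hB : PosOp.Decreases B B₀) :
    PosOp.Decreases (fun n => fixedSolution τ σ (A n) (B n)) (fixedSolution τ σ A₀ B₀) := by
  have hAi : ∀ n, (A n).Inv := fun n => hA₀.of_le (hA.le n)
  have hBi : ∀ n, (B n).Inv := fun n => hB₀.of_le (hB.le n)
  obtain ⟨L, hL⟩ := PosOp.exists_decreases (A := fun n => fixedSolution τ σ (A n) (B n))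
    fun i j hij => fixedSolution_mono hτ hσ hH hne (hAi j) (hBi j) (hA.1 hij) (hB.1 hij)
  have hle : fixedSolution τ σ A₀ B₀ ≤ L := hL.le_of_forall_le fun n =>
    fixedSolution_mono hτ hσ hH hne hA₀ hB₀ (hA.le n) (hB.le n)
  have hfix : L = deformMap τ σ A₀ B₀ L := by
    have h1 := (deformMap_decreases hτ hσ hA hB hL).2
    have h2 : ∀ n, deformMap τ σ (A n) (B n) (fixedSolution τ σ (A n) (B n)) =
        fixedSolution τ σ (A n) (B n) := fun n =>
      (isFixedSolution_fixedSolution hτ hσ hH hne (hAi n) (hBi n)).2.symm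
    simp only [h2] at h1
    exact hL.2.unique h1
  have hLX : L = fixedSolution τ σ A₀ B₀ := IsFixedSolution.eq_fixedSolution hτ hσ hH hne hA₀ hB₀
    ⟨(isFixedSolution_fixedSolution hτ hσ hH hne hA₀ hB₀).1.of_le hle, hfix⟩
  rwa [← hLX]

theorem exists_decreases_fixedSolution (A B : PosOp H) : ∃ L : PosOp H,
    PosOp.Decreases (fun n : ℕ => fixedSolution τ σ (A + PosOp.scalar H (1 / ((n : ℝ≥0) + 1)))
      (B + PosOp.scalar H (1 / ((n : ℝ≥0) + 1)))) L :=
  PosOp.exists_decreases fun i j hij => fixedSolution_mono hτ hσ hH hne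
    (A.inv_add_scalar (by positivity)) (B.inv_add_scalar (by positivity))
    (A.decreases_add_scalar.1 hij) (B.decreases_add_scalar.1 hij)

omit hτ hσ hH hne [Nontrivial H] in
/-- The deformation of `τ` by `σ`. -/
noncomputable def deformation (τ σ : PosOp H → PosOp H → PosOp H) (A B : PosOp H) : PosOp H :=
  Classical.epsilon fun L => PosOp.Decreases
    (fun n : ℕ => fixedSolution τ σ (A + PosOp.scalar H (1 / ((n : ℝ≥0) + 1)))
      (B + PosOp.scalar H (1 / ((n : ℝ≥0) + 1)))) L

theorem decreases_deformation (A B : PosOp H) : PosOp.Decreases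
    (fun n : ℕ => fixedSolution τ σ (A + PosOp.scalar H (1 / ((n : ℝ≥0) + 1)))
      (B + PosOp.scalar H (1 / ((n : ℝ≥0) + 1)))) (deformation τ σ A B) :=
  Classical.epsilon_spec (exists_decreases_fixedSolution hτ hσ hH hne A B)

theorem deformation_eq {A B : PosOp H} (hA : A.Inv) (hB : B.Inv) :
    deformation τ σ A B = fixedSolution τ σ A B :=
  (decreases_deformation hτ hσ hH hne A B).2.unique (fixedSolution_decreases hτ hσ hH hne hA hB
    A.decreases_add_scalar B.decreases_add_scalar).2

theorem deformation_le (A B : PosOp H) {ε : ℝ≥0} (hε : 0 < ε) : deformation τ σ A B ≤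
    fixedSolution τ σ (A + PosOp.scalar H ε) (B + PosOp.scalar H ε) := by
  obtain ⟨n, hn⟩ := exists_nat_one_div_lt hε
  exact ((decreases_deformation hτ hσ hH hne A B).le n).trans (fixedSolution_mono hτ hσ hH hne
    (A.inv_add_scalar (by positivity)) (B.inv_add_scalar (by positivity))
    (PosOp.add_scalar_mono le_rfl hn.le) (PosOp.add_scalar_mono le_rfl hn.le))

theorem le_deformation {A B W : PosOp H} (h : ∀ ε : ℝ≥0, 0 < ε →
    W ≤ fixedSolution τ σ (A + PosOp.scalar H ε) (B + PosOp.scalar H ε)) :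
    W ≤ deformation τ σ A B :=
  (decreases_deformation hτ hσ hH hne A B).le_of_forall_le fun n => h _ (by positivity)

theorem deformation_mono {A A' B B' : PosOp H} (hA : A ≤ A') (hB : B ≤ B') :
    deformation τ σ A B ≤ deformation τ σ A' B' :=
  le_deformation hτ hσ hH hne fun _ hε => (deformation_le hτ hσ hH hne A B hε).trans
    (fixedSolution_mono hτ hσ hH hne (A.inv_add_scalar hε) (B.inv_add_scalar hε)
      (PosOp.add_scalar_mono hA le_rfl) (PosOp.add_scalar_mono hB le_rfl))

/-- For `ε < 1/(n+1)` the value lies between the limit and the `n`-th term of the defining sequence.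
-/
theorem tendstoSOT_deformation (A B : PosOp H) : PosOp.TendstoSOT
    (fun ε : ℝ≥0 => deformation τ σ (A + PosOp.scalar H ε) (B + PosOp.scalar H ε))
    (𝓝[>] 0) (deformation τ σ A B) := by
  have hpos : ∀ᶠ ε : ℝ≥0 in 𝓝[>] 0, 0 < ε := self_mem_nhdsWithin
  refine PosOp.tendstoSOT_of_squeeze (decreases_deformation hτ hσ hH hne A B) ?_ fun n => ?_
  · filter_upwards [hpos] with ε hε
    rw [deformation_eq hτ hσ hH hne (A.inv_add_scalar hε) (B.inv_add_scalar hε)]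
    exact deformation_le hτ hσ hH hne A B hε
  · have hlt : ∀ᶠ ε : ℝ≥0 in 𝓝[>] 0, ε < 1 / ((n : ℝ≥0) + 1) :=
      nhdsWithin_le_nhds (gt_mem_nhds (by positivity))
    filter_upwards [hpos, hlt] with ε hε hεn
    rw [deformation_eq hτ hσ hH hne (A.inv_add_scalar hε) (B.inv_add_scalar hε)]
    exact fixedSolution_mono hτ hσ hH hne (A.inv_add_scalar hε) (B.inv_add_scalar hε)
      (PosOp.add_scalar_mono le_rfl hεn.le) (PosOp.add_scalar_mono le_rfl hεn.le)

theorem conj_deformation_le_of_inv (A B : PosOp H) {C : PosOp H} (hC : C.Inv) :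
    C.conj (deformation τ σ A B) ≤ deformation τ σ (C.conj A) (C.conj B) := by
  refine le_deformation hτ hσ hH hne fun ε hε => ?_
  -- Chosen so that `C (δ I) C ≤ ε I`; the added `1` keeps the denominator positive.
  set δ : ℝ≥0 := ε / (‖C.1 * C.1‖₊ + 1) with hδ
  have hδpos : 0 < δ := by positivity
  have hCδ : C.conj (PosOp.scalar H δ) ≤ PosOp.scalar H ε := by
    refine (PosOp.le_scalar_nnnorm _).trans (PosOp.scalar_mono ?_)
    rw [PosOp.coe_conj, PosOp.coe_scalar, mul_smul_comm, mul_one, smul_mul_assoc, nnnorm_smul,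
      Real.nnnorm_of_nonneg δ.coe_nonneg]
    change δ * _ ≤ ε
    rw [hδ, div_mul_eq_mul_div]
    refine div_le_of_le_mul₀ (by positivity) (by positivity) ?_
    gcongr
    exact le_self_add
  have hle : ∀ A : PosOp H, C.conj (A + PosOp.scalar H δ) ≤ C.conj A + PosOp.scalar H ε :=
    fun A => by
      rw [PosOp.conj_add]
      exact add_le_add_right (show (C.conj (PosOp.scalar H δ)).1 ≤ (PosOp.scalar H ε).1 from hCδ)
        (C.conj A).1
  refine (C.conj_mono (deformation_le hτ hσ hH hne A B hδpos)).trans ?_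
  rw [fixedSolution_conj hτ hσ hH hne (A.inv_add_scalar hδpos) (B.inv_add_scalar hδpos) hC]
  exact fixedSolution_mono hτ hσ hH hne ((A.inv_add_scalar hδpos).conj hC)
    ((B.inv_add_scalar hδpos).conj hC) (hle A) (hle B)

/-- A general `C` is approximated in norm by the invertible `C + I/(n+1)`. The resulting errors in
the arguments are absorbed by `ε I`, after which `n → ∞`. -/
theorem conj_deformation_le (A B C : PosOp H) :
    C.conj (deformation τ σ A B) ≤ deformation τ σ (C.conj A) (C.conj B) := by
  refine le_deformation hτ hσ hH hne fun ε hε => ?_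
  rw [← deformation_eq hτ hσ hH hne (PosOp.inv_add_scalar _ hε) (PosOp.inv_add_scalar _ hε)]
  set Cn : ℕ → PosOp H := fun n => C + PosOp.scalar H (1 / ((n : ℝ≥0) + 1)) with hCn
  have hlim : ∀ A : PosOp H, Tendsto (fun n => ((Cn n).conj A).1) atTop (𝓝 (C.conj A).1) :=
    fun A => by
      have h1 : Tendsto (fun n => (Cn n).1) atTop (𝓝 (C.1 + algebraMap ℝ≥0 _ 0)) :=
        (((continuous_algebraMap ℝ≥0 (H →L[ℂ] H)).tendsto 0).comp
          tendsto_one_div_add_atTop_nhds_zero_nat).const_add C.1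
      rw [map_zero, add_zero] at h1
      exact (h1.mul_const A.1).mul h1
  have hev : ∀ A : PosOp H, ∀ᶠ n in atTop, (Cn n).conj A ≤ C.conj A + PosOp.scalar H ε :=
    fun A => by
      have h1 := tendsto_iff_norm_sub_tendsto_zero.mp (hlim A)
      filter_upwards [h1.eventually (gt_mem_nhds (show (0 : ℝ) < ε by exact_mod_cast hε))]
        with n hn
      exact PosOp.le_add_scalar_of_norm_sub_le hn.le
  refine le_of_tendsto (a := (C.conj (deformation τ σ A B)).1) (hlim _) ?_
  filter_upwards [hev A, hev B] with n hnA hnB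
  exact (conj_deformation_le_of_inv hτ hσ hH hne A B (C.inv_add_scalar (by positivity))).trans
    (deformation_mono hτ hσ hH hne hnA hnB)

theorem isOperatorMean_deformation : IsOperatorMean (deformation τ σ) where
  mono A A' B B' hA hB := deformation_mono hτ hσ hH hne hA hB
  transformer A B C := conj_deformation_le hτ hσ hH hne A B C
  downward A B A₀ B₀ hA hB := by
    obtain ⟨L, hL⟩ := PosOp.exists_decreases (A := fun n => deformation τ σ (A n) (B n))
      fun i j hij => deformation_mono hτ hσ hH hne (hA.1 hij) (hB.1 hij)
    have h1 : deformation τ σ A₀ B₀ ≤ L := hL.le_of_forall_le fun n =>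
      deformation_mono hτ hσ hH hne (hA.le n) (hB.le n)
    -- The limits are interchanged: with `ε` fixed, `n → ∞` is governed by the invertible case, and
    -- only then does `ε` decrease.
    have h2 : L ≤ deformation τ σ A₀ B₀ := le_deformation hτ hσ hH hne fun ε hε =>
      hL.2.le (fixedSolution_decreases hτ hσ hH hne (A₀.inv_add_scalar hε) (B₀.inv_add_scalar hε)
        (hA.add_scalar ε) (hB.add_scalar ε)).2
        (Eventually.of_forall fun n => deformation_le hτ hσ hH hne (A n) (B n) hε)
    rwa [← le_antisymm h2 h1]
  normalized := by
    have h1 : (PosOp.scalar H 1).Inv := PosOp.scalar_inv one_ne_zero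
    rw [deformation_eq hτ hσ hH hne h1 h1]
    exact (IsFixedSolution.eq_fixedSolution hτ hσ hH hne h1 h1
      ⟨h1, (deformMap_scalar hτ hσ one_ne_zero).symm⟩).symm

/-- The regularisation only evaluates the operation at invertible pairs, where the fixed point
equation determines it. -/
theorem isDeformation_iff (ρ : PosOp H → PosOp H → PosOp H) :
    IsDeformation τ σ ρ ↔ ρ = deformation τ σ := by
  constructor
  · intro h
    have heq : ∀ A B : PosOp H, A.Inv → B.Inv → ρ A B = deformation τ σ A B :=
      fun A B hA hB => by
        rw [deformation_eq hτ hσ hH hne hA hB]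
        exact (h.solution A B hA hB).1.eq_fixedSolution hτ hσ hH hne hA hB
    funext A B
    refine (h.regularization A B).unique fun ξ => ?_
    refine (tendstoSOT_deformation hτ hσ hH hne A B ξ).congr' ?_
    filter_upwards [self_mem_nhdsWithin] with ε hε
    rw [heq _ _ (A.inv_add_scalar hε) (B.inv_add_scalar hε)]
  · rintro rfl
    refine ⟨fun A B hA hB => ?_, tendstoSOT_deformation hτ hσ hH hne⟩
    rw [deformation_eq hτ hσ hH hne hA hB]
    exact ⟨isFixedSolution_fixedSolution hτ hσ hH hne hA hB,
      fun X hX => hX.eq_fixedSolution hτ hσ hH hne hA hB⟩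

theorem scalar_solution_iff {t x : ℝ≥0} (ht : 0 < t) (hx : 0 < x) :
    τ (σ (PosOp.scalar H x) (PosOp.scalar H 1)) (σ (PosOp.scalar H x) (PosOp.scalar H t)) =
      PosOp.scalar H x ↔ x = repFun (deformation τ σ) t := by
  have h1 : (PosOp.scalar H 1).Inv := PosOp.scalar_inv one_ne_zero
  have h2 : (PosOp.scalar H t).Inv := PosOp.scalar_inv ht.ne'
  have h3 := (isOperatorMean_deformation hτ hσ hH hne).one_scalar t
  rw [deformation_eq hτ hσ hH hne h1 h2] at h3
  constructor
  · intro h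
    have h4 := IsFixedSolution.eq_fixedSolution hτ hσ hH hne h1 h2
      ⟨PosOp.scalar_inv hx.ne', h.symm⟩
    exact PosOp.scalar_injective (h4.trans h3)
  · intro h
    rw [h, ← h3]
    exact (isFixedSolution_fixedSolution hτ hσ hH hne h1 h2).2.symm

omit hH hne in
-- By homogeneity the operator equation reads `x f_σ(1/x) f_τ(f_σ(t/x)/f_σ(1/x)) = x`, and `x`
-- cancels.
theorem scalar_equation_iff {t x : ℝ≥0} (hx : 0 < x) :
    repFun σ (1 / x) * repFun τ (repFun σ (t / x) / repFun σ (1 / x)) = 1 ↔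
      τ (σ (PosOp.scalar H x) (PosOp.scalar H 1)) (σ (PosOp.scalar H x) (PosOp.scalar H t)) =
        PosOp.scalar H x := by
  have h1 : 0 < repFun σ (1 / x) := hσ.repFun_pos (by positivity)
  rw [hσ.scalar_scalar hx.ne', hσ.scalar_scalar hx.ne',
    hτ.scalar_scalar (mul_ne_zero hx.ne' h1.ne'), mul_div_mul_left _ _ hx.ne', mul_assoc]
  constructor
  · intro h; rw [h, mul_one]
  · intro h
    exact (mul_eq_left₀ hx.ne').mp (PosOp.scalar_injective h)

end Deformation

theorem theorem2p7 {H : Type*} [NormedAddCommGroup H] [InnerProductSpace ℂ H] [CompleteSpace H]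
    [TopologicalSpace.SeparableSpace H] (hH : ¬ FiniteDimensional ℂ H)
    (τ σ : PosOp H → PosOp H → PosOp H) (hτ : IsOperatorMean τ) (hσ : IsOperatorMean σ)
    (hσl : σ ≠ leftMean H) :
    (∀ A B : PosOp H, A.Inv → B.Inv → ∃! X : PosOp H, IsFixedSolution τ σ A B X) ∧
    ∃ ρ : PosOp H → PosOp H → PosOp H,
      (∀ ρ' : PosOp H → PosOp H → PosOp H, IsDeformation τ σ ρ' ↔ ρ' = ρ) ∧
      IsOperatorMean ρ ∧
      ∃ fτ fσ f : ℝ≥0 → ℝ≥0,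
        IsRepresentingFunction τ fτ ∧ IsRepresentingFunction σ fσ ∧
        IsRepresentingFunction ρ f ∧
        ∀ t : ℝ≥0, 0 < t → 0 < f t ∧ ∀ x : ℝ≥0, 0 < x →
          (τ (σ (PosOp.scalar H x) (PosOp.scalar H 1)) (σ (PosOp.scalar H x) (PosOp.scalar H t)) =
              PosOp.scalar H x ↔ x = f t) ∧
          (fσ (1 / x) * fτ (fσ (t / x) / fσ (1 / x)) = 1 ↔ x = f t) := by

  have hn : Nontrivial H := by
    by_contra h
    rw [not_nontrivial_iff_subsingleton] at h
    exact hH inferInstance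
  have hρ := isOperatorMean_deformation hτ hσ hH hσl
  refine ⟨fun A B hA hB => existsUnique_isFixedSolution hτ hσ hH hσl hA hB,
    deformation τ σ, isDeformation_iff hτ hσ hH hσl, hρ,
    repFun τ, repFun σ, repFun (deformation τ σ), hτ.isRepresentingFunction,
    hσ.isRepresentingFunction, hρ.isRepresentingFunction, fun t ht => ⟨hρ.repFun_pos ht,
      fun x hx => ⟨scalar_solution_iff hτ hσ hH hσl ht hx, ?_⟩⟩⟩
  rw [scalar_equation_iff hτ hσ hx, scalar_solution_iff hτ hσ hH hσl ht hx]
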